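/- **Language.** Let $V=\{x_0,x_1,x_2,\dots\}$ be a countable set of propositional variables and let $C$ be any set of propositional constants containing two distinct constants $\top,\bot$. The set $Fm(C)$ of formulas is built from $V\cup C$ with $\neg,\rightarrow,\vee,\wedge$, the identity connective $\equiv$, the modal operator $\square$ and the quantifier $\forall$, where $\forall x\varphi$ is a formula only if $x$ belongs to the set $fvar(\varphi)$ of free variables of $\varphi$. A substitution $\sigma\colon V\to Fm(C)$ acts on formulas by leaving constants fixed, commuting with the connectives, and $(\forall x\varphi)[\sigma]=\forall y(\varphi[\sigma[x:=y]])$, where $y$ is the least variable greater than all variables occurring free in some $\sigma(u)$, $u\in fvar(\forall x\varphi)$. $\varphi[x:=\psi]$ is the result of the substitution that maps $x$ to $\psi$ and every other variable to itself. $\varphi=_\alpha\psi$ means that $\varphi$ and $\psi$ differ at most in their bound variables. **Axioms and derivations.** $\mathbb{AX}^-$ is the smallest set of formulas that contains all formulas of $Fm(C)$ of the forms: substitution-instances of classical propositional tautologies; $\square\varphi\to\varphi$; $\square(\varphi\to\psi)\to(\square\varphi\to\square\psi)$; $\square(\varphi\to\psi)\to\square(\square\varphi\to\square\psi)$; $\varphi\equiv\psi$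 whenever $\varphi=_\alpha\psi$; $(\varphi\equiv\psi)\to(\varphi\to\psi)$; $(\psi\equiv\psi')\to(\varphi[x:=\psi]\equiv\varphi[x:=\psi'])$ if $x\in fvar(\varphi)$; $\forall x\varphi\to\varphi[x:=\psi]$; $\forall x(\varphi\to\psi)\to(\forall x\varphi\to\forall x\psi)$; $\forall x(\varphi\to\psi)\to(\varphi\to\forall x\psi)$ if $x\notin fvar(\varphi)$; $\square\forall x\varphi\to\forall x\square\varphi$; and such that $\forall x\varphi\in\mathbb{AX}^-$ whenever $\varphi\in\mathbb{AX}^-$ and $x\in fvar(\varphi)$. We write $\Phi\vdash\varphi$ if $\varphi$ is derivable from $\Phi$ by means of the axioms in $\mathbb{AX}^-$, Modus Ponens, and Axiom Necessitation (if $\varphi\in\mathbb{AX}^-$, infer $\square\varphi$). **Semantics.** A simple model $\mathcal M$ consists of a non-empty set $M$, sets $\mathit{NEC}\subseteq\mathit{TRUE}\subseteq M$, a function $\varGamma\colon C\to M$, and an extension of every assignment $\gamma\colon V\to M$ to a function $\gamma\colon Fm(C)\to M$, such that for all assignments $\gamma,\gamma'$, all substitutions $\sigma\colon V\to Fm(C)$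 and all formulas $\varphi,\psi$: $\gamma(c)=\varGamma(c)$ for $c\in C$; if $\gamma(x)=\gamma'(x)$ for all $x\in fvar(\varphi)$, then $\gamma(\varphi)=\gamma'(\varphi)$; $\gamma(\varphi[\sigma])=\gamma\sigma(\varphi)$, where $\gamma\sigma$ is the assignment $x\mapsto\gamma(\sigma(x))$; and 1. $\varGamma(\bot)\notin\mathit{TRUE}$ and $\varGamma(\top)\in\mathit{TRUE}$; 2. $\gamma(\varphi\to\psi)\in\mathit{TRUE}$ iff $\gamma(\varphi)\notin\mathit{TRUE}$ or $\gamma(\psi)\in\mathit{TRUE}$; 3. $\gamma(\neg\varphi)\in\mathit{TRUE}$ iff $\gamma(\varphi)\notin\mathit{TRUE}$; 4. $\gamma(\varphi\wedge\psi)\in\mathit{TRUE}$ iff $\gamma(\varphi)\in\mathit{TRUE}$ and $\gamma(\psi)\in\mathit{TRUE}$; 5. $\gamma(\varphi\vee\psi)\in\mathit{TRUE}$ iff $\gamma(\varphi)\in\mathit{TRUE}$ or $\gamma(\psi)\in\mathit{TRUE}$; 6. $\gamma(\square\varphi)\in\mathit{TRUE}$ iff $\gamma(\varphi)\in\mathit{NEC}$;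 7. $\gamma(\varphi\equiv\psi)\in\mathit{TRUE}$ iff $\gamma(\varphi)=\gamma(\psi)$; 8. if $x\in fvar(\varphi)$, then $\gamma(\forall x\varphi)\in\mathit{TRUE}$ iff $\gamma_x^a(\varphi)\in\mathit{TRUE}$ for all $a\in M$, where $\gamma_x^a$ is the assignment that maps $x$ to $a$ and agrees with $\gamma$ elsewhere; 9. if $\gamma(\varphi\to\psi)\in\mathit{NEC}$, then $\gamma(\square\varphi\to\square\psi)\in\mathit{NEC}$; 10. if $x\in fvar(\varphi)$ and $\gamma(\forall x\varphi)\in\mathit{NEC}$, then $\gamma_x^a(\varphi)\in\mathit{NEC}$ for all $a\in M$. $\mathcal M$ is admissible if $\gamma(\varphi)\in\mathit{NEC}$ for every assignment $\gamma\colon V\to M$ and every $\varphi\in\mathbb{AX}^-$. We write $(\mathcal M,\gamma)\vDash\varphi$ if $\gamma(\varphi)\in\mathit{TRUE}$, and $\Phi\Vdash\varphi$ if for every admissible simple model $\mathcal M$ and every assignment $\gamma\colon V\to M$, $(\mathcal M,\gamma)\vDash\psi$ for all $\psi\in\Phi$ implies $(\mathcal M,\gamma)\vDash\varphi$. **Theorem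 (Soundness and Completeness of $\mathbb{AX}^-$).** For all $\Phi\cup\{\varphi\}\subseteq Fm(C)$, $$\Phi\vdash\varphi\iff\Phi\Vdash\varphi .$$ -/

import Mathlib

universe u v w

namespace NonFregean

/-- The propositional constants: `⊤`, `⊥`, and any further constants, listed by `K`. -/
inductive Cst (K : Type u) : Type u where
  | top : Cst K
  | bot : Cst K
  | other (k : K) : Cst K

/-- Strings built from the variables `x₀, x₁, …` (indexed by `ℕ`), the constants, the connectives
and the quantifier. The formulas are those in which every quantifier binds a variable that occurs
free in its scope, see `PreFm.WF` and `Fm`. -/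
inductive PreFm (K : Type u) : Type u where
  | var (x : ℕ) : PreFm K
  | cst (c : Cst K) : PreFm K
  | neg (φ : PreFm K) : PreFm K
  | imp (φ ψ : PreFm K) : PreFm K
  | or (φ ψ : PreFm K) : PreFm K
  | and (φ ψ : PreFm K) : PreFm K
  | ident (φ ψ : PreFm K) : PreFm K
  | box (φ : PreFm K) : PreFm K
  | all (x : ℕ) (φ : PreFm K) : PreFm K

namespace PreFm

variable {K : Type u}

/-- The free variables. -/
def fvar : PreFm K → Finset ℕ
  | var x => {x}
  | cst _ => ∅
  | neg φ => φ.fvar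
  | imp φ ψ => φ.fvar ∪ ψ.fvar
  | or φ ψ => φ.fvar ∪ ψ.fvar
  | and φ ψ => φ.fvar ∪ ψ.fvar
  | ident φ ψ => φ.fvar ∪ ψ.fvar
  | box φ => φ.fvar
  | all x φ => φ.fvar.erase x

/-- There is no vacuous quantification: `∀ x φ` is a formula only if `x` is free in `φ`. -/
def WF : PreFm K → Prop
  | var _ => True
  | cst _ => True
  | neg φ => φ.WF
  | imp φ ψ => φ.WF ∧ ψ.WF
  | or φ ψ => φ.WF ∧ ψ.WF
  | and φ ψ => φ.WF ∧ ψ.WF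
  | ident φ ψ => φ.WF ∧ ψ.WF
  | box φ => φ.WF
  | all x φ => x ∈ φ.fvar ∧ φ.WF

/-- The variable forced by `σ` with respect to a formula whose free variables are `s`: the least
variable greater than all variables that are free in some `σ u`, `u ∈ s`. (Substitutions of
variables fix the constants, which contribute no free variables.) -/
def forced (σ : ℕ → PreFm K) (s : Finset ℕ) : ℕ :=
  (s.biUnion fun u => (σ u).fvar).sup Nat.succ

theorem forced_isLeast (σ : ℕ → PreFm K) (s : Finset ℕ) :
    IsLeast {y : ℕ | ∀ u ∈ s, ∀ z ∈ (σ u).fvar, z < y} (forced σ s) := by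
  constructor
  · intro u hu z hz
    exact Nat.lt_of_succ_le
      (Finset.le_sup (f := Nat.succ) (Finset.mem_biUnion.2 ⟨u, hu, hz⟩))
  · intro y hy
    refine Finset.sup_le fun z hz => ?_
    obtain ⟨u, hu, hz⟩ := Finset.mem_biUnion.1 hz
    exact Nat.succ_le_of_lt (hy u hu z hz)

/-- Simultaneous substitution of `σ x` for the free occurrences of each variable `x`, where
`(∀ x φ)[σ] = ∀ y (φ[σ[x := y]])` with `y` the variable forced by `σ` with respect to `∀ x φ`. -/
def subst : PreFm K → (ℕ → PreFm K) → PreFm K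
  | var x, σ => σ x
  | cst c, _ => cst c
  | neg φ, σ => neg (φ.subst σ)
  | imp φ ψ, σ => imp (φ.subst σ) (ψ.subst σ)
  | or φ ψ, σ => or (φ.subst σ) (ψ.subst σ)
  | and φ ψ, σ => and (φ.subst σ) (ψ.subst σ)
  | ident φ ψ, σ => ident (φ.subst σ) (ψ.subst σ)
  | box φ, σ => box (φ.subst σ)
  | all x φ, σ =>
      all (forced σ (φ.fvar.erase x))
        (φ.subst (Function.update σ x (var (forced σ (φ.fvar.erase x)))))

/-- `x` and `y` denote the same thing under the list `l` of pairs of corresponding bound variables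
(innermost first): they are bound by corresponding quantifiers, or both free and equal. -/
def SameVar : List (ℕ × ℕ) → ℕ → ℕ → Prop
  | [], x, y => x = y
  | (a, b) :: l, x, y => (x = a ∧ y = b) ∨ (x ≠ a ∧ y ≠ b ∧ SameVar l x y)

/-- The two strings differ at most in their bound variables, relative to a list of pairs of
variables that are already bound by corresponding quantifiers. -/
def AlphaUnder : List (ℕ × ℕ) → PreFm K → PreFm K → Prop
  | l, var x, var y => SameVar l x y
  | _, cst c, cst d => c = d
  | l, neg φ, neg φ' => AlphaUnder l φ φ'
  | l, imp φ ψ, imp φ' ψ' => AlphaUnder l φ φ' ∧ AlphaUnder l ψ ψ'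
  | l, or φ ψ, or φ' ψ' => AlphaUnder l φ φ' ∧ AlphaUnder l ψ ψ'
  | l, and φ ψ, and φ' ψ' => AlphaUnder l φ φ' ∧ AlphaUnder l ψ ψ'
  | l, ident φ ψ, ident φ' ψ' => AlphaUnder l φ φ' ∧ AlphaUnder l ψ ψ'
  | l, box φ, box φ' => AlphaUnder l φ φ'
  | l, all x φ, all y φ' => AlphaUnder ((x, y) :: l) φ φ'
  | _, _, _ => False

theorem mem_fvar_subst {φ : PreFm K} {σ : ℕ → PreFm K} {x z : ℕ}
    (hx : x ∈ φ.fvar) (hz : z ∈ (σ x).fvar) : z ∈ (φ.subst σ).fvar := by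
  induction φ generalizing σ with
  | var y =>
    simp only [fvar, Finset.mem_singleton] at hx
    subst hx
    exact hz
  | cst c => simp [fvar] at hx
  | neg φ ih => exact ih hx hz
  | box φ ih => exact ih hx hz
  | imp φ ψ ih₁ ih₂ | or φ ψ ih₁ ih₂ | and φ ψ ih₁ ih₂ | ident φ ψ ih₁ ih₂ =>
    simp only [subst, fvar, Finset.mem_union] at hx ⊢
    exact hx.imp (fun h => ih₁ h hz) (fun h => ih₂ h hz)
  | all y φ ih =>
    have hlt := (forced_isLeast σ (φ.fvar.erase y)).1 x hx z hz
    have hx' := Finset.mem_erase.1 hx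
    simp only [subst, fvar, Finset.mem_erase]
    refine ⟨hlt.ne, ih hx'.2 ?_⟩
    rwa [Function.update_of_ne hx'.1]

theorem WF.subst {φ : PreFm K} {σ : ℕ → PreFm K} (hφ : φ.WF) (hσ : ∀ x, (σ x).WF) :
    (φ.subst σ).WF := by
  induction φ generalizing σ with
  | var y => exact hσ y
  | cst c => trivial
  | neg φ ih => exact ih hφ hσ
  | box φ ih => exact ih hφ hσ
  | imp φ ψ ih₁ ih₂ | or φ ψ ih₁ ih₂ | and φ ψ ih₁ ih₂ | ident φ ψ ih₁ ih₂ =>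
    exact ⟨ih₁ hφ.1 hσ, ih₂ hφ.2 hσ⟩
  | all y φ ih =>
    refine ⟨mem_fvar_subst hφ.1 (by simp [fvar]), ih hφ.2 fun x => ?_⟩
    by_cases h : x = y
    · subst h
      simp [WF]
    · rw [Function.update_of_ne h]
      exact hσ x

end PreFm

/-- The set `Fm(C)` of formulas, where `C` consists of `⊤`, `⊥` and the elements of `K`. -/
def Fm (K : Type u) : Type u := {φ : PreFm K // φ.WF}

namespace Fm

variable {K : Type u}

def fvar (φ : Fm K) : Finset ℕ := φ.1.fvar

def var (x : ℕ) : Fm K := ⟨.var x, trivial⟩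

def cst (c : Cst K) : Fm K := ⟨.cst c, trivial⟩

def neg (φ : Fm K) : Fm K := ⟨.neg φ.1, φ.2⟩

def imp (φ ψ : Fm K) : Fm K := ⟨.imp φ.1 ψ.1, φ.2, ψ.2⟩

def or (φ ψ : Fm K) : Fm K := ⟨.or φ.1 ψ.1, φ.2, ψ.2⟩

def and (φ ψ : Fm K) : Fm K := ⟨.and φ.1 ψ.1, φ.2, ψ.2⟩

/-- The identity connective `φ ≡ ψ`. -/
def ident (φ ψ : Fm K) : Fm K := ⟨.ident φ.1 ψ.1, φ.2, ψ.2⟩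

/-- The modal operator `□ φ`. -/
def box (φ : Fm K) : Fm K := ⟨.box φ.1, φ.2⟩

/-- The quantifier `∀ x φ`, which requires `x` to be free in `φ`. -/
def all (x : ℕ) (φ : Fm K) (h : x ∈ φ.fvar) : Fm K := ⟨.all x φ.1, h, φ.2⟩

theorem mem_fvar_imp_right {x : ℕ} {φ ψ : Fm K} (h : x ∈ ψ.fvar) : x ∈ (φ.imp ψ).fvar :=
  Finset.mem_union_right _ h

/-- `φ[σ]` for a substitution `σ : V → Fm(C)`. -/
def subst (φ : Fm K) (σ : ℕ → Fm K) : Fm K :=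
  ⟨φ.1.subst fun x => (σ x).1, φ.2.subst fun x => (σ x).2⟩

/-- `φ[x := ψ]`. -/
def subst1 (φ : Fm K) (x : ℕ) (ψ : Fm K) : Fm K :=
  φ.subst (Function.update var x ψ)

/-- Alpha-congruence: the formulas differ at most in their bound variables. -/
def Alpha (φ ψ : Fm K) : Prop := PreFm.AlphaUnder [] φ.1 ψ.1

end Fm

/-- Formulas of basic propositional logic. -/
inductive PropFm : Type where
  | var (x : ℕ) : PropFm
  | top : PropFm
  | bot : PropFm
  | neg (p : PropFm) : PropFm
  | imp (p q : PropFm) : PropFm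
  | or (p q : PropFm) : PropFm
  | and (p q : PropFm) : PropFm

namespace PropFm

/-- Classical truth under a valuation of the variables. -/
def Holds (e : ℕ → Prop) : PropFm → Prop
  | var x => e x
  | top => True
  | bot => False
  | neg p => ¬ p.Holds e
  | imp p q => p.Holds e → q.Holds e
  | or p q => p.Holds e ∨ q.Holds e
  | and p q => p.Holds e ∧ q.Holds e

def Tautology (p : PropFm) : Prop := ∀ e : ℕ → Prop, p.Holds e

/-- The formula that results from `p` by uniformly replacing each variable `x` by `σ x`
(`σ = Fm.var` gives `p` itself). -/
def inst {K : Type u} (σ : ℕ → Fm K) : PropFm → Fm K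
  | var x => σ x
  | top => Fm.cst Cst.top
  | bot => Fm.cst Cst.bot
  | neg p => (p.inst σ).neg
  | imp p q => (p.inst σ).imp (q.inst σ)
  | or p q => (p.inst σ).or (q.inst σ)
  | and p q => (p.inst σ).and (q.inst σ)

end PropFm

/-- The set `AX⁻` of axioms. -/
inductive AXminus {K : Type u} : Fm K → Prop where
  | taut (p : PropFm) (hp : p.Tautology) (σ : ℕ → Fm K) : AXminus (p.inst σ)
  /-- `□φ → φ` -/
  | box_elim (φ : Fm K) : AXminus (φ.box.imp φ)
  /-- `□(φ → ψ) → (□φ → □ψ)` -/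
  | box_imp (φ ψ : Fm K) : AXminus ((φ.imp ψ).box.imp (φ.box.imp ψ.box))
  /-- `□(φ → ψ) → □(□φ → □ψ)` -/
  | box_imp_box (φ ψ : Fm K) : AXminus ((φ.imp ψ).box.imp (φ.box.imp ψ.box).box)
  /-- `φ ≡ ψ` for alpha-congruent `φ`, `ψ` -/
  | ident_alpha (φ ψ : Fm K) (h : φ.Alpha ψ) : AXminus (φ.ident ψ)
  /-- `(φ ≡ ψ) → (φ → ψ)` -/
  | ident_imp (φ ψ : Fm K) : AXminus ((φ.ident ψ).imp (φ.imp ψ))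
  /-- `(ψ ≡ ψ') → (φ[x := ψ] ≡ φ[x := ψ'])`, if `x` is free in `φ` -/
  | ident_subst (x : ℕ) (φ ψ ψ' : Fm K) (hx : x ∈ φ.fvar) :
      AXminus ((ψ.ident ψ').imp ((φ.subst1 x ψ).ident (φ.subst1 x ψ')))
  /-- `∀x φ → φ[x := ψ]` -/
  | all_elim (x : ℕ) (φ ψ : Fm K) (hx : x ∈ φ.fvar) :
      AXminus ((φ.all x hx).imp (φ.subst1 x ψ))
  /-- `∀x (φ → ψ) → (∀x φ → ∀x ψ)` -/
  | all_imp (x : ℕ) (φ ψ : Fm K) (hφ : x ∈ φ.fvar) (hψ : x ∈ ψ.fvar) :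
      AXminus (((φ.imp ψ).all x (Fm.mem_fvar_imp_right hψ)).imp
        ((φ.all x hφ).imp (ψ.all x hψ)))
  /-- `∀x (φ → ψ) → (φ → ∀x ψ)`, if `x` is not free in `φ` -/
  | all_imp_const (x : ℕ) (φ ψ : Fm K) (hφ : x ∉ φ.fvar) (hψ : x ∈ ψ.fvar) :
      AXminus (((φ.imp ψ).all x (Fm.mem_fvar_imp_right hψ)).imp (φ.imp (ψ.all x hψ)))
  /-- `□∀x φ → ∀x □φ` -/
  | box_all (x : ℕ) (φ : Fm K) (hx : x ∈ φ.fvar) :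
      AXminus ((φ.all x hx).box.imp (φ.box.all x hx))
  /-- closure under universal quantification -/
  | gen (x : ℕ) (φ : Fm K) (hx : x ∈ φ.fvar) (h : AXminus φ) : AXminus (φ.all x hx)

/-- `Φ ⊢ φ`: derivability with the axioms `AX⁻`, Modus Ponens and Axiom Necessitation. -/
inductive Derives {K : Type u} (Φ : Set (Fm K)) : Fm K → Prop where
  | hyp {φ : Fm K} (h : φ ∈ Φ) : Derives Φ φ
  | ax {φ : Fm K} (h : AXminus φ) : Derives Φ φ
  | an {φ : Fm K} (h : AXminus φ) : Derives Φ φ.box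
  | mp {φ ψ : Fm K} (h₁ : Derives Φ φ) (h₂ : Derives Φ (φ.imp ψ)) : Derives Φ ψ

/-- Simple models. The extension `γ ↦ (φ ↦ γ(φ))` of assignments to formulas is not determined by
the remaining components, so it is a component `ext` of the model. -/
structure SimpleModel (K : Type u) where
  M : Type w
  nonempty : Nonempty M
  TRUE : Set M
  NEC : Set M
  nec_subset : NEC ⊆ TRUE
  Γ : Cst K → M
  ext : (ℕ → M) → Fm K → M
  ext_var : ∀ (γ : ℕ → M) (x : ℕ), ext γ (Fm.var x) = γ x
  ext_cst : ∀ (γ : ℕ → M) (c : Cst K), ext γ (Fm.cst c) = Γ c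
  coincidence : ∀ (γ γ' : ℕ → M) (φ : Fm K), (∀ x ∈ φ.fvar, γ x = γ' x) → ext γ φ = ext γ' φ
  substitution : ∀ (σ : ℕ → Fm K) (γ : ℕ → M) (φ : Fm K),
    ext γ (φ.subst σ) = ext (fun x => ext γ (σ x)) φ
  bot_not_true : Γ Cst.bot ∉ TRUE
  top_true : Γ Cst.top ∈ TRUE
  imp_true : ∀ (γ : ℕ → M) (φ ψ : Fm K),
    ext γ (φ.imp ψ) ∈ TRUE ↔ ext γ φ ∉ TRUE ∨ ext γ ψ ∈ TRUE
  neg_true : ∀ (γ : ℕ → M) (φ : Fm K), ext γ φ.neg ∈ TRUE ↔ ext γ φ ∉ TRUE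
  and_true : ∀ (γ : ℕ → M) (φ ψ : Fm K),
    ext γ (φ.and ψ) ∈ TRUE ↔ ext γ φ ∈ TRUE ∧ ext γ ψ ∈ TRUE
  or_true : ∀ (γ : ℕ → M) (φ ψ : Fm K),
    ext γ (φ.or ψ) ∈ TRUE ↔ ext γ φ ∈ TRUE ∨ ext γ ψ ∈ TRUE
  box_true : ∀ (γ : ℕ → M) (φ : Fm K), ext γ φ.box ∈ TRUE ↔ ext γ φ ∈ NEC
  ident_true : ∀ (γ : ℕ → M) (φ ψ : Fm K), ext γ (φ.ident ψ) ∈ TRUE ↔ ext γ φ = ext γ ψ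
  all_true : ∀ (γ : ℕ → M) (x : ℕ) (φ : Fm K) (hx : x ∈ φ.fvar),
    ext γ (φ.all x hx) ∈ TRUE ↔ ∀ a : M, ext (Function.update γ x a) φ ∈ TRUE
  imp_nec : ∀ (γ : ℕ → M) (φ ψ : Fm K),
    ext γ (φ.imp ψ) ∈ NEC → ext γ (φ.box.imp ψ.box) ∈ NEC
  all_nec : ∀ (γ : ℕ → M) (x : ℕ) (φ : Fm K) (hx : x ∈ φ.fvar),
    ext γ (φ.all x hx) ∈ NEC → ∀ a : M, ext (Function.update γ x a) φ ∈ NEC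

namespace SimpleModel

variable {K : Type u}

/-- Every assignment sends every axiom to a necessary proposition. -/
def Admissible (𝓜 : SimpleModel.{u, w} K) : Prop :=
  ∀ (γ : ℕ → 𝓜.M) (φ : Fm K), AXminus φ → 𝓜.ext γ φ ∈ 𝓜.NEC

/-- Satisfaction `(𝓜, γ) ⊨ φ`. -/
def Sat (𝓜 : SimpleModel.{u, w} K) (γ : ℕ → 𝓜.M) (φ : Fm K) : Prop :=
  𝓜.ext γ φ ∈ 𝓜.TRUE

end SimpleModel

/-- `Φ ⊩ φ`: logical consequence over admissible simple models. The universes of the models range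
over all types of a level that is at least that of the language. -/
def Entails {K : Type u} (Φ : Set (Fm K)) (φ : Fm K) : Prop :=
  ∀ 𝓜 : SimpleModel.{u, max u v} K, 𝓜.Admissible →
    ∀ γ : ℕ → 𝓜.M, (∀ ψ ∈ Φ, 𝓜.Sat γ ψ) → 𝓜.Sat γ φ

end NonFregean

/-! Soundness is immediate: admissibility makes every axiom necessary, hence true, which also covers
Axiom Necessitation.

For completeness, suppose `φ` is not derivable, so that `Φ` with `φ.neg` added is consistent. This
set may use every variable and uncountably many constants, so a direct Henkin construction lacks
both fresh witnesses and an enumeration. A finite subset has neither defect: some variable is always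
fresh, and only finitely many constants occur. Over those constants the language is countable, and a
generic ideal of finite consistent sets gives a maximal consistent set with variables as witnesses
(`Consistent.exists_isHenkin_of_countable`). Pulling it back along a collapse of the other constants
gives one in the full language (`Consistent.exists_isHenkin`).

Each Henkin set yields a term model: formulas modulo provable identity, where a formula denotes the
class of its substitution instance. An ultraproduct of these models over the finite subsets
satisfies the whole set (`Consistent.exists_model`).

The term models rest on three facts. Substitutions compose literally (`PreFm.subst_subst`). Identity
is a congruence for simultaneous substitution (`IsHenkin.ident_subst`). Axioms are closed under
substitution up to bound variables (`AXminus.exists_nf_eq_subst`), which gives admissibility. -/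

namespace NonFregean

/-! ### Substitution and alpha-congruence on strings -/

namespace PreFm

variable {K : Type u}

theorem forced_congr {σ τ : ℕ → PreFm K} {s : Finset ℕ} (h : ∀ x ∈ s, σ x = τ x) :
    forced σ s = forced τ s := by
  unfold forced
  rw [Finset.biUnion_congr rfl fun x hx => by rw [h x hx]]

/-- The result of a substitution depends only on its values at the free variables. -/
theorem subst_congr {φ : PreFm K} {σ τ : ℕ → PreFm K} (h : ∀ x ∈ φ.fvar, σ x = τ x) :
    φ.subst σ = φ.subst τ := by
  induction φ generalizing σ τ with
  | var y => exact h y (by simp [fvar])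
  | cst c => rfl
  | neg φ ih | box φ ih => simp only [subst, ih h]
  | imp φ ψ ih₁ ih₂ | or φ ψ ih₁ ih₂ | and φ ψ ih₁ ih₂ | ident φ ψ ih₁ ih₂ =>
    simp only [fvar, Finset.mem_union] at h
    simp only [subst, ih₁ fun x hx => h x (Or.inl hx), ih₂ fun x hx => h x (Or.inr hx)]
  | all y φ ih =>
    simp only [subst, forced_congr (s := φ.fvar.erase y) h]
    congr 1
    refine ih fun x hx => ?_
    by_cases hxy : x = y
    · subst hxy; simp
    · rw [Function.update_of_ne hxy, Function.update_of_ne hxy]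
      exact h x (Finset.mem_erase.2 ⟨hxy, hx⟩)

theorem erase_biUnion_update (s : Finset ℕ) (σ : ℕ → PreFm K) (x z : ℕ)
    (hz : ∀ u ∈ s.erase x, z ∉ (σ u).fvar) :
    (s.biUnion fun u => (Function.update σ x (var z) u).fvar).erase z =
      (s.erase x).biUnion fun u => (σ u).fvar := by
  ext w
  simp only [Finset.mem_erase, Finset.mem_biUnion]
  constructor
  · rintro ⟨hw, u, hu, hwu⟩
    by_cases hux : u = x
    · subst hux
      simp [fvar] at hwu
      exact absurd hwu hw
    · rw [Function.update_of_ne hux] at hwu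
      exact ⟨u, ⟨hux, hu⟩, hwu⟩
  · rintro ⟨u, ⟨hux, hu⟩, hwu⟩
    refine ⟨fun h => hz u (Finset.mem_erase.2 ⟨hux, hu⟩) (h ▸ hwu), u, hu, ?_⟩
    rwa [Function.update_of_ne hux]

theorem forced_notMem {σ : ℕ → PreFm K} {s : Finset ℕ} {u : ℕ} (hu : u ∈ s) :
    forced σ s ∉ (σ u).fvar :=
  fun h => lt_irrefl _ ((forced_isLeast σ s).1 u hu _ h)

theorem fvar_subst (φ : PreFm K) (σ : ℕ → PreFm K) :
    (φ.subst σ).fvar = φ.fvar.biUnion fun u => (σ u).fvar := by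
  induction φ generalizing σ with
  | var y => simp [subst, fvar]
  | cst c => simp [subst, fvar]
  | neg φ ih | box φ ih => exact ih σ
  | imp φ ψ ih₁ ih₂ | or φ ψ ih₁ ih₂ | and φ ψ ih₁ ih₂ | ident φ ψ ih₁ ih₂ =>
    simp only [subst, fvar, ih₁, ih₂, Finset.union_biUnion]
  | all y φ ih =>
    simp only [subst, fvar, ih]
    exact erase_biUnion_update _ _ _ _ fun u hu => forced_notMem hu

theorem forced_biUnion (s : Finset ℕ) (σ τ : ℕ → PreFm K) :
    forced τ (s.biUnion fun u => (σ u).fvar) = forced (fun u => (σ u).subst τ) s := by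
  simp only [forced, fvar_subst, Finset.biUnion_biUnion]

/-- Substituting into `∀ z (φ[σ[x := z]])`, for sufficiently fresh `z`, amounts to substituting
into `∀ x φ`; this reduces to the corresponding fact about `φ`. -/
theorem all_subst_of_subst_subst {φ : PreFm K} {x z : ℕ} {σ τ : ℕ → PreFm K}
    (hφ : ∀ σ τ : ℕ → PreFm K, (φ.subst σ).subst τ = φ.subst fun u => (σ u).subst τ)
    (hz : ∀ u ∈ φ.fvar.erase x, z ∉ (σ u).fvar) :
    (all z (φ.subst (Function.update σ x (var z)))).subst τ =
      (all x φ).subst fun u => (σ u).subst τ := by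
  simp only [subst, fvar_subst, erase_biUnion_update _ _ _ _ hz, forced_biUnion, hφ]
  congr 1
  refine subst_congr fun u hu => ?_
  by_cases hux : u = x
  · subst hux; simp [subst]
  · simp only [Function.update_of_ne hux]
    refine subst_congr fun w hw => ?_
    rw [Function.update_of_ne]
    rintro rfl
    exact hz u (Finset.mem_erase.2 ⟨hux, hu⟩) hw

/-- A literal equality, not one up to alpha: the final bound name depends only on the free variables
of the composed values, so both sides pick the same one (`forced_biUnion`). -/
theorem subst_subst (φ : PreFm K) (σ τ : ℕ → PreFm K) :
    (φ.subst σ).subst τ = φ.subst fun u => (σ u).subst τ := by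
  induction φ generalizing σ τ with
  | var y => rfl
  | cst c => rfl
  | neg φ ih | box φ ih => simp only [subst, ih]
  | imp φ ψ ih₁ ih₂ | or φ ψ ih₁ ih₂ | and φ ψ ih₁ ih₂ | ident φ ψ ih₁ ih₂ =>
    simp only [subst, ih₁, ih₂]
  | all y φ ih => exact all_subst_of_subst_subst ih fun u hu => forced_notMem hu

theorem all_subst {φ : PreFm K} {x z : ℕ} {σ : ℕ → PreFm K} (τ : ℕ → PreFm K)
    (hz : ∀ u ∈ φ.fvar.erase x, z ∉ (σ u).fvar) :
    (all z (φ.subst (Function.update σ x (var z)))).subst τ = ((all x φ).subst σ).subst τ := by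
  rw [all_subst_of_subst_subst (subst_subst φ) hz, subst_subst]

/-- Putting a closed formula for `x` removes its contribution. The forced variable can then be read
off a substitution result, which is what can be compared for alpha-congruent bodies. -/
theorem forced_eq_sup (φ : PreFm K) (x : ℕ) (σ : ℕ → PreFm K) :
    forced σ (φ.fvar.erase x) =
      (φ.subst (Function.update σ x (cst .top))).fvar.sup Nat.succ := by
  rw [fvar_subst, forced]
  congr 1
  ext w
  simp only [Finset.mem_biUnion, Finset.mem_erase]
  constructor
  · rintro ⟨u, ⟨hux, hu⟩, hw⟩
    exact ⟨u, hu, by rwa [Function.update_of_ne hux]⟩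
  · rintro ⟨u, hu, hw⟩
    by_cases hux : u = x
    · subst hux; simp [fvar] at hw
    · rw [Function.update_of_ne hux] at hw
      exact ⟨u, ⟨hux, hu⟩, hw⟩

/-- Substitution discards the old bound names and chooses new ones canonically, so alpha-congruence
becomes equality. -/
theorem AlphaUnder.subst_eq {l : List (ℕ × ℕ)} {φ ψ : PreFm K} {σ τ : ℕ → PreFm K}
    (h : AlphaUnder l φ ψ) (hl : ∀ u v, SameVar l u v → σ u = τ v) :
    φ.subst σ = ψ.subst τ := by
  induction φ generalizing l ψ σ τ with
  | var x =>
    cases ψ with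
    | var y => exact hl x y h
    | _ => exact h.elim
  | cst c =>
    cases ψ with
    | cst d => cases h; rfl
    | _ => exact h.elim
  | neg φ ih =>
    cases ψ with
    | neg ψ => exact congrArg neg (ih h hl)
    | _ => exact h.elim
  | box φ ih =>
    cases ψ with
    | box ψ => exact congrArg box (ih h hl)
    | _ => exact h.elim
  | imp φ₁ φ₂ ih₁ ih₂ =>
    cases ψ with
    | imp ψ₁ ψ₂ => exact congrArg₂ imp (ih₁ h.1 hl) (ih₂ h.2 hl)
    | _ => exact h.elim
  | or φ₁ φ₂ ih₁ ih₂ =>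
    cases ψ with
    | or ψ₁ ψ₂ => exact congrArg₂ or (ih₁ h.1 hl) (ih₂ h.2 hl)
    | _ => exact h.elim
  | and φ₁ φ₂ ih₁ ih₂ =>
    cases ψ with
    | and ψ₁ ψ₂ => exact congrArg₂ and (ih₁ h.1 hl) (ih₂ h.2 hl)
    | _ => exact h.elim
  | ident φ₁ φ₂ ih₁ ih₂ =>
    cases ψ with
    | ident ψ₁ ψ₂ => exact congrArg₂ ident (ih₁ h.1 hl) (ih₂ h.2 hl)
    | _ => exact h.elim
  | all x φ ih =>
    cases ψ with
    | all y ψ =>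
      have key (θ : PreFm K) :
          φ.subst (Function.update σ x θ) = ψ.subst (Function.update τ y θ) := by
        refine ih (l := (x, y) :: l) h fun u v huv => ?_
        rcases huv with ⟨rfl, rfl⟩ | ⟨hu, hv, huv⟩
        · simp
        · rw [Function.update_of_ne hu, Function.update_of_ne hv, hl u v huv]
      have hf : forced σ (φ.fvar.erase x) = forced τ (ψ.fvar.erase y) := by
        rw [forced_eq_sup, forced_eq_sup, key]
      simp only [subst, hf, key]
    | _ => exact h.elim

/-- A formula is alpha-congruent to its image under a variable renaming that matches the list of
bound variables. -/
theorem alphaUnder_subst {l : List (ℕ × ℕ)} {φ : PreFm K} {σ : ℕ → PreFm K}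
    (h : ∀ u ∈ φ.fvar, ∃ v, σ u = var v ∧ SameVar l u v) : AlphaUnder l φ (φ.subst σ) := by
  induction φ generalizing l σ with
  | var x =>
    obtain ⟨v, hv, hl⟩ := h x (by simp [fvar])
    simp only [subst, hv]
    exact hl
  | cst c => simp only [subst, AlphaUnder]
  | neg φ ih | box φ ih => exact ih h
  | imp φ ψ ih₁ ih₂ | or φ ψ ih₁ ih₂ | and φ ψ ih₁ ih₂ | ident φ ψ ih₁ ih₂ =>
    simp only [fvar, Finset.mem_union] at h
    exact ⟨ih₁ fun u hu => h u (Or.inl hu), ih₂ fun u hu => h u (Or.inr hu)⟩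
  | all x φ ih =>
    refine ih (l := (x, _) :: l) fun u hu => ?_
    by_cases hux : u = x
    · subst hux
      exact ⟨_, by simp, Or.inl ⟨rfl, rfl⟩⟩
    · have hu' : u ∈ φ.fvar.erase x := Finset.mem_erase.2 ⟨hux, hu⟩
      obtain ⟨v, hv, hl⟩ := h u hu'
      refine ⟨v, by rw [Function.update_of_ne hux, hv], Or.inr ⟨hux, ?_, hl⟩⟩
      rintro rfl
      exact forced_notMem (σ := σ) hu' (by rw [hv]; simp [fvar])

/-- Mirror image of `alphaUnder_subst`; with both at hand, symmetry of alpha-congruence is not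
needed. -/
theorem subst_alphaUnder {l : List (ℕ × ℕ)} {φ : PreFm K} {σ : ℕ → PreFm K}
    (h : ∀ u ∈ φ.fvar, ∃ v, σ u = var v ∧ SameVar l v u) : AlphaUnder l (φ.subst σ) φ := by
  induction φ generalizing l σ with
  | var x =>
    obtain ⟨v, hv, hl⟩ := h x (by simp [fvar])
    simp only [subst, hv]
    exact hl
  | cst c => simp only [subst, AlphaUnder]
  | neg φ ih | box φ ih => exact ih h
  | imp φ ψ ih₁ ih₂ | or φ ψ ih₁ ih₂ | and φ ψ ih₁ ih₂ | ident φ ψ ih₁ ih₂ =>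
    simp only [fvar, Finset.mem_union] at h
    exact ⟨ih₁ fun u hu => h u (Or.inl hu), ih₂ fun u hu => h u (Or.inr hu)⟩
  | all x φ ih =>
    refine ih (l := (_, x) :: l) fun u hu => ?_
    by_cases hux : u = x
    · subst hux
      exact ⟨_, by simp, Or.inl ⟨rfl, rfl⟩⟩
    · have hu' : u ∈ φ.fvar.erase x := Finset.mem_erase.2 ⟨hux, hu⟩
      obtain ⟨v, hv, hl⟩ := h u hu'
      refine ⟨v, by rw [Function.update_of_ne hux, hv], Or.inr ⟨?_, hux, hl⟩⟩
      rintro rfl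
      exact forced_notMem (σ := σ) hu' (by rw [hv]; simp [fvar])

/-! ### Replacement of constants and countability -/

/-- Replacing the constants. -/
def map {L : Type v} (r : Cst K → Cst L) : PreFm K → PreFm L
  | var x => var x
  | cst c => cst (r c)
  | neg φ => neg (φ.map r)
  | imp φ ψ => imp (φ.map r) (ψ.map r)
  | or φ ψ => or (φ.map r) (ψ.map r)
  | and φ ψ => and (φ.map r) (ψ.map r)
  | ident φ ψ => ident (φ.map r) (ψ.map r)
  | box φ => box (φ.map r)
  | all x φ => all x (φ.map r)

theorem fvar_map {L : Type v} (r : Cst K → Cst L) (φ : PreFm K) : (φ.map r).fvar = φ.fvar := by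
  induction φ <;> simp_all [map, fvar]

theorem WF.map {L : Type v} {r : Cst K → Cst L} {φ : PreFm K} (h : φ.WF) : (φ.map r).WF := by
  induction φ <;> simp_all [PreFm.map, WF, fvar_map]

theorem map_subst {L : Type v} (r : Cst K → Cst L) (φ : PreFm K) (σ : ℕ → PreFm K) :
    (φ.subst σ).map r = (φ.map r).subst fun x => (σ x).map r := by
  induction φ generalizing σ with
  | var y => rfl
  | cst c => rfl
  | neg φ ih | box φ ih => simp only [subst, map, ih]
  | imp φ ψ ih₁ ih₂ | or φ ψ ih₁ ih₂ | and φ ψ ih₁ ih₂ | ident φ ψ ih₁ ih₂ =>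
    simp only [subst, map, ih₁, ih₂]
  | all y φ ih =>
    simp only [subst, map, ih, fvar_map, forced]
    congr 1
    refine congrArg _ (funext fun x => ?_)
    by_cases h : x = y
    · subst h; simp [map]
    · simp only [Function.update_of_ne h]

theorem AlphaUnder.map {L : Type v} (r : Cst K → Cst L) {l : List (ℕ × ℕ)} {φ ψ : PreFm K}
    (h : AlphaUnder l φ ψ) : AlphaUnder l (φ.map r) (ψ.map r) := by
  induction φ generalizing l ψ <;> cases ψ <;> simp_all [AlphaUnder, PreFm.map]

/-- The constants occurring in a formula. -/
def consts : PreFm K → Set (Cst K)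
  | var _ => ∅
  | cst c => {c}
  | neg φ | box φ | all _ φ => φ.consts
  | imp φ ψ | or φ ψ | and φ ψ | ident φ ψ => φ.consts ∪ ψ.consts

theorem finite_consts (φ : PreFm K) : φ.consts.Finite := by
  induction φ <;> simp_all [consts]

theorem map_map_of_consts {L : Type v} {r : Cst K → Cst L} {s : Cst L → Cst K} {φ : PreFm K}
    (h : ∀ c ∈ φ.consts, s (r c) = c) : (φ.map r).map s = φ := by
  induction φ with
  | var y => rfl
  | cst c => exact congrArg cst (h c rfl)
  | neg φ ih | box φ ih | all x φ ih => simp only [map, ih h]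
  | imp φ ψ ih₁ ih₂ | or φ ψ ih₁ ih₂ | and φ ψ ih₁ ih₂ | ident φ ψ ih₁ ih₂ =>
    simp only [map, ih₁ fun c hc => h c (Or.inl hc), ih₂ fun c hc => h c (Or.inr hc)]

/-- An encoding of formulas by numbers, relative to one of the constants. -/
def code (e : Cst K → ℕ) : PreFm K → ℕ
  | var x => Nat.pair 0 x
  | cst c => Nat.pair 1 (e c)
  | neg φ => Nat.pair 2 (φ.code e)
  | imp φ ψ => Nat.pair 3 (Nat.pair (φ.code e) (ψ.code e))
  | or φ ψ => Nat.pair 4 (Nat.pair (φ.code e) (ψ.code e))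
  | and φ ψ => Nat.pair 5 (Nat.pair (φ.code e) (ψ.code e))
  | ident φ ψ => Nat.pair 6 (Nat.pair (φ.code e) (ψ.code e))
  | box φ => Nat.pair 7 (φ.code e)
  | all x φ => Nat.pair 8 (Nat.pair x (φ.code e))

theorem code_injective {e : Cst K → ℕ} (he : Function.Injective e) :
    Function.Injective (code e) := by
  intro φ
  induction φ <;> intro ψ h <;> cases ψ <;> simp only [code, Nat.pair_eq_pair] at h <;>
    first
      | (exfalso; omega)
      | (simp only [var.injEq, cst.injEq, neg.injEq, imp.injEq, or.injEq, and.injEq,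
          ident.injEq, box.injEq, all.injEq]
         grind [Function.Injective])

end PreFm

/-! ### Substitution and normal forms for formulas -/

namespace Fm

variable {K : Type u}

theorem ext {φ ψ : Fm K} (h : φ.1 = ψ.1) : φ = ψ := Subtype.ext h

theorem subst_congr {φ : Fm K} {σ τ : ℕ → Fm K} (h : ∀ x ∈ φ.fvar, σ x = τ x) :
    φ.subst σ = φ.subst τ :=
  ext (PreFm.subst_congr fun x hx => congrArg Subtype.val (h x hx))

theorem subst_subst (φ : Fm K) (σ τ : ℕ → Fm K) :
    (φ.subst σ).subst τ = φ.subst fun u => (σ u).subst τ :=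
  ext (PreFm.subst_subst _ _ _)

theorem fvar_subst (φ : Fm K) (σ : ℕ → Fm K) :
    (φ.subst σ).fvar = φ.fvar.biUnion fun u => (σ u).fvar :=
  PreFm.fvar_subst _ _

theorem fvar_var (x : ℕ) : (var x : Fm K).fvar = {x} := rfl

theorem mem_fvar_subst {φ : Fm K} {σ : ℕ → Fm K} {x z : ℕ} (hx : x ∈ φ.fvar)
    (hz : z ∈ (σ x).fvar) : z ∈ (φ.subst σ).fvar :=
  PreFm.mem_fvar_subst hx hz

theorem mem_fvar_subst_update {φ : Fm K} {x : ℕ} (hx : x ∈ φ.fvar) (σ : ℕ → Fm K) (z : ℕ) :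
    z ∈ (φ.subst (Function.update σ x (var z))).fvar :=
  mem_fvar_subst hx (by simp [fvar_var])

theorem val_update (σ : ℕ → Fm K) (x : ℕ) (ψ : Fm K) :
    (fun u => (Function.update σ x ψ u).1) = Function.update (fun u => (σ u).1) x ψ.1 := by
  funext u
  by_cases h : u = x
  · subst h; simp
  · simp only [Function.update_of_ne h]

/-- The variable forced by `σ` with respect to `∀ x φ`. -/
def bound (φ : Fm K) (σ : ℕ → Fm K) (x : ℕ) : ℕ :=
  PreFm.forced (fun u => (σ u).1) (φ.fvar.erase x)

theorem bound_notMem {φ : Fm K} {σ : ℕ → Fm K} {x u : ℕ} (hu : u ∈ φ.fvar) (hux : u ≠ x) :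
    φ.bound σ x ∉ (σ u).fvar :=
  PreFm.forced_notMem (σ := fun u => (σ u).1) (Finset.mem_erase.2 ⟨hux, hu⟩)

theorem all_subst_eq {φ : Fm K} {x : ℕ} (hx : x ∈ φ.fvar) (σ : ℕ → Fm K) :
    (φ.all x hx).subst σ =
      (φ.subst (Function.update σ x (var (φ.bound σ x)))).all (φ.bound σ x)
        (mem_fvar_subst_update hx σ _) := by
  refine ext ?_
  simp only [subst, all, val_update]
  rfl

/-- If `z` is fresh, substituting `z` for `x` and then `ψ` for `z` amounts to substituting `ψ`
for `x`, except that the other values get renamed. -/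
theorem subst_update_subst {φ : Fm K} {x z : ℕ} {σ : ℕ → Fm K} (τ : ℕ → Fm K) (ψ : Fm K)
    (hz : ∀ u ∈ φ.fvar, u ≠ x → z ∉ (σ u).fvar) :
    (φ.subst (Function.update σ x (var z))).subst (Function.update τ z ψ) =
      φ.subst (Function.update (fun u => (σ u).subst τ) x ψ) := by
  rw [subst_subst]
  refine subst_congr fun u hu => ?_
  by_cases hux : u = x
  · subst hux
    simp only [Function.update_self]
    exact Function.update_self (f := τ) z ψ
  · simp only [Function.update_of_ne hux]
    refine subst_congr fun w hw => ?_
    rw [Function.update_of_ne]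
    rintro rfl
    exact hz u hu hux hw

/-- The normal form of a formula up to renaming of bound variables. -/
def nf (φ : Fm K) : Fm K := φ.subst var

theorem fvar_nf (φ : Fm K) : φ.nf.fvar = φ.fvar := by
  rw [nf, fvar_subst]
  ext x
  simp [fvar_var]

theorem var_subst (x : ℕ) (σ : ℕ → Fm K) : (var x).subst σ = σ x := ext rfl

theorem nf_subst (φ : Fm K) (σ : ℕ → Fm K) : φ.nf.subst σ = φ.subst σ := by
  rw [nf, subst_subst]
  exact subst_congr fun x _ => var_subst x σ

theorem nf_nf (φ : Fm K) : φ.nf.nf = φ.nf := nf_subst φ var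

theorem imp_subst (φ ψ : Fm K) (σ : ℕ → Fm K) :
    (φ.imp ψ).subst σ = (φ.subst σ).imp (ψ.subst σ) := rfl

theorem box_subst (φ : Fm K) (σ : ℕ → Fm K) : φ.box.subst σ = (φ.subst σ).box := rfl

theorem nf_imp_congr {φ φ' ψ ψ' : Fm K} (h : φ.nf = φ'.nf) (h' : ψ.nf = ψ'.nf) :
    (φ.imp ψ).nf = (φ'.imp ψ').nf :=
  congrArg₂ imp h h'

theorem nf_ident_congr {φ φ' ψ ψ' : Fm K} (h : φ.nf = φ'.nf) (h' : ψ.nf = ψ'.nf) :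
    (φ.ident ψ).nf = (φ'.ident ψ').nf :=
  congrArg₂ ident h h'

theorem nf_box_congr {φ ψ : Fm K} (h : φ.nf = ψ.nf) : φ.box.nf = ψ.box.nf :=
  congrArg box h

theorem subst_eq_of_nf_eq {φ ψ : Fm K} (h : φ.nf = ψ.nf) (σ : ℕ → Fm K) :
    φ.subst σ = ψ.subst σ := by
  rw [← nf_subst, h, nf_subst]

theorem fvar_eq_of_nf_eq {φ ψ : Fm K} (h : φ.nf = ψ.nf) : φ.fvar = ψ.fvar := by
  rw [← fvar_nf, h, fvar_nf]

theorem Alpha.subst_eq {φ ψ : Fm K} (h : φ.Alpha ψ) (σ : ℕ → Fm K) : φ.subst σ = ψ.subst σ :=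
  ext (PreFm.AlphaUnder.subst_eq h fun u v huv => by rw [show u = v from huv])

theorem alpha_nf (φ : Fm K) : φ.Alpha φ.nf :=
  PreFm.alphaUnder_subst fun u _ => ⟨u, rfl, rfl⟩

theorem nf_alpha (φ : Fm K) : φ.nf.Alpha φ :=
  PreFm.subst_alphaUnder fun u _ => ⟨u, rfl, rfl⟩

/-- Renaming the bound variable of `∀ x φ` under a substitution to any fresh variable. -/
theorem nf_all_subst {φ : Fm K} {x z : ℕ} (hx : x ∈ φ.fvar) {σ : ℕ → Fm K}
    (hz : ∀ u ∈ φ.fvar, u ≠ x → z ∉ (σ u).fvar) :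
    ((φ.subst (Function.update σ x (var z))).all z (mem_fvar_subst_update hx σ z)).nf =
      ((φ.all x hx).subst σ).nf := by
  refine ext ?_
  simp only [nf, subst, all, val_update]
  exact PreFm.all_subst _ fun u hu => hz u (Finset.mem_of_mem_erase hu) (Finset.ne_of_mem_erase hu)

theorem nf_all_congr {φ ψ : Fm K} {x : ℕ} (hφ : x ∈ φ.fvar) (hψ : x ∈ ψ.fvar)
    (h : φ.nf = ψ.nf) : (φ.all x hφ).nf = (ψ.all x hψ).nf := by
  have hb : φ.bound var x = ψ.bound var x := by
    unfold bound
    rw [fvar_eq_of_nf_eq h]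
  simp only [nf, all_subst_eq, hb, subst_eq_of_nf_eq h]

theorem subst_subst1 (φ ψ : Fm K) (x : ℕ) (σ : ℕ → Fm K) :
    (φ.subst1 x ψ).subst σ = φ.subst (Function.update σ x (ψ.subst σ)) := by
  rw [subst1, subst_subst]
  refine subst_congr fun u _ => ?_
  by_cases h : u = x
  · subst h; simp
  · simp only [Function.update_of_ne h, var_subst]

theorem nf_subst_congr {φ : Fm K} {σ τ : ℕ → Fm K} (h : ∀ u ∈ φ.fvar, (σ u).nf = (τ u).nf) :
    (φ.subst σ).nf = (φ.subst τ).nf := by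
  simp only [nf, subst_subst]
  exact subst_congr h

/-- Links the single substitutions of the axioms with the simultaneous ones of the semantics. Normal
forms appear because substituting for `z` also renames bound variables inside the other values of
`σ`. -/
theorem nf_subst_update_subst1 {φ : Fm K} {x z : ℕ} {σ : ℕ → Fm K} (ψ : Fm K)
    (hz : ∀ u ∈ φ.fvar, u ≠ x → z ∉ (σ u).fvar) :
    ((φ.subst (Function.update σ x (var z))).subst1 z ψ).nf =
      (φ.subst (Function.update σ x ψ)).nf := by
  rw [subst1, subst_update_subst var ψ hz]
  refine nf_subst_congr fun u _ => ?_
  by_cases h : u = x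
  · subst h; simp
  · simp only [Function.update_of_ne h]
    exact nf_nf _

/-- Even a substitution that replaces nothing renames bound variables, hence the normal form. -/
theorem subst1_of_notMem {φ : Fm K} {x : ℕ} (hx : x ∉ φ.fvar) (ψ : Fm K) :
    φ.subst1 x ψ = φ.nf :=
  subst_congr fun u hu => Function.update_of_ne (by rintro rfl; exact hx hu) _ _

/-- Replacing the constants. -/
def map {L : Type v} (r : Cst K → Cst L) (φ : Fm K) : Fm L := ⟨φ.1.map r, φ.2.map⟩

theorem fvar_map {L : Type v} (r : Cst K → Cst L) (φ : Fm K) : (φ.map r).fvar = φ.fvar :=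
  PreFm.fvar_map r φ.1

theorem map_subst {L : Type v} (r : Cst K → Cst L) (φ : Fm K) (σ : ℕ → Fm K) :
    (φ.subst σ).map r = (φ.map r).subst fun x => (σ x).map r :=
  ext (PreFm.map_subst r _ _)

theorem map_subst1 {L : Type v} (r : Cst K → Cst L) (φ : Fm K) (x : ℕ) (ψ : Fm K) :
    (φ.subst1 x ψ).map r = (φ.map r).subst1 x (ψ.map r) := by
  rw [subst1, map_subst]
  refine subst_congr fun u _ => ?_
  by_cases h : u = x
  · subst h; simp
  · simp only [Function.update_of_ne h]
    rfl

instance [Countable K] : Countable (Fm K) := by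
  obtain ⟨e, he⟩ := exists_injective_nat K
  let e' : Cst K → ℕ
    | .top => 0
    | .bot => 1
    | .other k => e k + 2
  have he' : Function.Injective e' := by
    intro c d h
    cases c <;> cases d <;> simp [e'] at h ⊢
    exact he h
  exact ((PreFm.code_injective he').comp Subtype.val_injective).countable

end Fm

/-! ### Closure properties of the axioms -/

theorem PropFm.subst_inst {K : Type u} (p : PropFm) (σ τ : ℕ → Fm K) :
    (p.inst σ).subst τ = p.inst fun x => (σ x).subst τ := by
  induction p with
  | var x => rfl
  | top | bot => rfl
  | neg p ih => exact congrArg Fm.neg ih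
  | imp p q ihp ihq => exact congrArg₂ Fm.imp ihp ihq
  | or p q ihp ihq => exact congrArg₂ Fm.or ihp ihq
  | and p q ihp ihq => exact congrArg₂ Fm.and ihp ihq

theorem PropFm.map_inst {K : Type u} {L : Type v} {r : Cst K → Cst L} (ht : r .top = .top)
    (hb : r .bot = .bot) (p : PropFm) (σ : ℕ → Fm K) :
    (p.inst σ).map r = p.inst fun x => (σ x).map r := by
  induction p with
  | var x => rfl
  | top => exact congrArg Fm.cst ht
  | bot => exact congrArg Fm.cst hb
  | neg p ih => exact congrArg Fm.neg ih
  | imp p q ihp ihq => exact congrArg₂ Fm.imp ihp ihq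
  | or p q ihp ihq => exact congrArg₂ Fm.or ihp ihq
  | and p q ihp ihq => exact congrArg₂ Fm.and ihp ihq

variable {K : Type u}

/-- Only the tautologies single out constants, so `r` may be any map fixing `⊤` and `⊥`; injectivity
plays no role. -/
theorem AXminus.map {L : Type v} {r : Cst K → Cst L} (ht : r .top = .top) (hb : r .bot = .bot)
    {φ : Fm K} (h : AXminus φ) : AXminus (φ.map r) := by
  induction h with
  | taut p hp σ =>
    rw [PropFm.map_inst ht hb]
    exact taut p hp _
  | box_elim φ => exact box_elim (φ.map r)
  | box_imp φ ψ => exact box_imp (φ.map r) (ψ.map r)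
  | box_imp_box φ ψ => exact box_imp_box (φ.map r) (ψ.map r)
  | ident_alpha φ ψ h => exact ident_alpha (φ.map r) (ψ.map r) (PreFm.AlphaUnder.map r h)
  | ident_imp φ ψ => exact ident_imp (φ.map r) (ψ.map r)
  | ident_subst x φ ψ ψ' hx =>
    have := ident_subst x (φ.map r) (ψ.map r) (ψ'.map r) (by rwa [Fm.fvar_map])
    rw [← Fm.map_subst1, ← Fm.map_subst1] at this
    exact this
  | all_elim x φ ψ hx =>
    have := all_elim x (φ.map r) (ψ.map r) (by rwa [Fm.fvar_map])
    rw [← Fm.map_subst1] at this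
    exact this
  | all_imp x φ ψ hφ hψ =>
    exact all_imp x (φ.map r) (ψ.map r) (by rwa [Fm.fvar_map]) (by rwa [Fm.fvar_map])
  | all_imp_const x φ ψ hφ hψ =>
    exact all_imp_const x (φ.map r) (ψ.map r) (by rwa [Fm.fvar_map]) (by rwa [Fm.fvar_map])
  | box_all x φ hx => exact box_all x (φ.map r) (by rwa [Fm.fvar_map])
  | gen x φ hx _ ih => exact gen x (φ.map r) (by rwa [Fm.fvar_map]) ih

/-- Up to renaming of bound variables, the set of axioms is closed under substitution. -/
theorem AXminus.exists_nf_eq_subst {φ : Fm K} (h : AXminus φ) (σ : ℕ → Fm K) :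
    ∃ χ, AXminus χ ∧ χ.nf = (φ.subst σ).nf := by
  induction h generalizing σ with
  | taut p hp τ => exact ⟨_, taut p hp _, by rw [PropFm.subst_inst]⟩
  | box_elim φ => exact ⟨_, box_elim (φ.subst σ), rfl⟩
  | box_imp φ ψ => exact ⟨_, box_imp (φ.subst σ) (ψ.subst σ), rfl⟩
  | box_imp_box φ ψ => exact ⟨_, box_imp_box (φ.subst σ) (ψ.subst σ), rfl⟩
  | ident_alpha φ ψ h =>
    -- Both sides of the identity become the same formula under `σ`, so any alpha axiom about that
    -- formula serves.
    refine ⟨_, ident_alpha (φ.subst σ) (φ.subst σ).nf (Fm.alpha_nf _), ?_⟩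
    exact Fm.nf_ident_congr rfl ((Fm.nf_nf _).trans (congrArg Fm.nf (h.subst_eq σ)))
  | ident_imp φ ψ => exact ⟨_, ident_imp (φ.subst σ) (ψ.subst σ), rfl⟩
  | ident_subst x φ ψ ψ' hx =>
    have hz (θ : Fm K) := (Fm.nf_subst_update_subst1 (z := φ.bound σ x) (σ := σ) (θ.subst σ)
      fun u => Fm.bound_notMem (x := x)).trans (congrArg Fm.nf (Fm.subst_subst1 φ θ x σ).symm)
    exact ⟨_, ident_subst (φ.bound σ x) _ (ψ.subst σ) (ψ'.subst σ)
      (Fm.mem_fvar_subst_update hx σ _),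
      Fm.nf_imp_congr rfl (Fm.nf_ident_congr (hz ψ) (hz ψ'))⟩
  | all_elim x φ ψ hx =>
    have hz (θ : Fm K) := (Fm.nf_subst_update_subst1 (z := φ.bound σ x) (σ := σ) (θ.subst σ)
      fun u => Fm.bound_notMem (x := x)).trans (congrArg Fm.nf (Fm.subst_subst1 φ θ x σ).symm)
    exact ⟨_, all_elim (φ.bound σ x) _ (ψ.subst σ) (Fm.mem_fvar_subst_update hx σ _),
      Fm.nf_imp_congr (congrArg Fm.nf (Fm.all_subst_eq hx σ).symm) (hz ψ)⟩
  | all_imp x φ ψ hφ hψ =>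
    -- The variable forced by the implication is fresh for both parts, but each quantified part
    -- alone may force a smaller one; `Fm.nf_all_subst` absorbs the difference.
    set z := (φ.imp ψ).bound σ x with hz
    have hz₁ : ∀ u ∈ φ.fvar, u ≠ x → z ∉ (σ u).fvar := fun u hu hux =>
      Fm.bound_notMem (Finset.mem_union_left _ hu) hux
    have hz₂ : ∀ u ∈ ψ.fvar, u ≠ x → z ∉ (σ u).fvar := fun u hu hux =>
      Fm.bound_notMem (Finset.mem_union_right _ hu) hux
    refine ⟨_, all_imp z (φ.subst (Function.update σ x (.var z)))
      (ψ.subst (Function.update σ x (.var z))) (Fm.mem_fvar_subst_update hφ _ _)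
      (Fm.mem_fvar_subst_update hψ _ _), ?_⟩
    rw [Fm.imp_subst, Fm.imp_subst]
    refine Fm.nf_imp_congr ?_ (Fm.nf_imp_congr (Fm.nf_all_subst hφ hz₁) (Fm.nf_all_subst hψ hz₂))
    exact congrArg Fm.nf (Fm.all_subst_eq (Fm.mem_fvar_imp_right hψ) σ).symm
  | all_imp_const x φ ψ hφ hψ =>
    set z := (φ.imp ψ).bound σ x with hz
    have hz₁ : ∀ u ∈ φ.fvar, z ∉ (σ u).fvar := fun u hu =>
      Fm.bound_notMem (Finset.mem_union_left _ hu) (by rintro rfl; exact hφ hu)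
    have hz₂ : ∀ u ∈ ψ.fvar, u ≠ x → z ∉ (σ u).fvar := fun u hu hux =>
      Fm.bound_notMem (Finset.mem_union_right _ hu) hux
    have hφσ : φ.subst (Function.update σ x (.var z)) = φ.subst σ :=
      Fm.subst_congr fun u hu => Function.update_of_ne (by rintro rfl; exact hφ hu) _ _
    refine ⟨_, all_imp_const z (φ.subst (Function.update σ x (.var z)))
      (ψ.subst (Function.update σ x (.var z))) ?_ (Fm.mem_fvar_subst_update hψ _ _), ?_⟩
    · rw [hφσ, Fm.fvar_subst]
      simpa using hz₁
    · rw [Fm.imp_subst, Fm.imp_subst]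
      refine Fm.nf_imp_congr ?_ (Fm.nf_imp_congr (congrArg Fm.nf hφσ) (Fm.nf_all_subst hψ hz₂))
      exact congrArg Fm.nf (Fm.all_subst_eq (Fm.mem_fvar_imp_right hψ) σ).symm
  | box_all x φ hx =>
    refine ⟨_, box_all (φ.bound σ x) (φ.subst (Function.update σ x (.var (φ.bound σ x))))
      (Fm.mem_fvar_subst_update hx _ _), ?_⟩
    rw [Fm.imp_subst, Fm.box_subst]
    refine Fm.nf_imp_congr (Fm.nf_box_congr (congrArg Fm.nf (Fm.all_subst_eq hx σ).symm)) ?_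
    exact congrArg Fm.nf (Fm.all_subst_eq (φ := φ.box) hx σ).symm
  | gen x φ hx _ ih =>
    obtain ⟨χ, hχ, hχφ⟩ := ih (Function.update σ x (.var (φ.bound σ x)))
    have hmem : φ.bound σ x ∈ χ.fvar := by
      rw [Fm.fvar_eq_of_nf_eq hχφ]
      exact Fm.mem_fvar_subst_update hx _ _
    refine ⟨_, gen _ χ hmem hχ, ?_⟩
    rw [Fm.all_subst_eq hx]
    exact Fm.nf_all_congr _ _ hχφ

/-! ### Derived rules -/

namespace Derives

variable {Φ Ψ : Set (Fm K)} {φ ψ χ : Fm K}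

theorem mono (hΦ : Φ ⊆ Ψ) (h : Derives Φ φ) : Derives Ψ φ := by
  induction h with
  | hyp h => exact hyp (hΦ h)
  | ax h => exact ax h
  | an h => exact an h
  | mp _ _ ih₁ ih₂ => exact mp ih₁ ih₂

theorem map {L : Type v} {r : Cst K → Cst L} (ht : r .top = .top) (hb : r .bot = .bot)
    (h : Derives Φ φ) : Derives (Fm.map r '' Φ) (φ.map r) := by
  induction h with
  | hyp h => exact hyp ⟨_, h, rfl⟩
  | ax h => exact ax (h.map ht hb)
  | an h => exact an (h.map ht hb)
  | mp _ _ ih₁ ih₂ => exact mp ih₁ ih₂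

/-- Substitution instances of tautologies in at most three variables. -/
theorem taut (p : PropFm) (hp : p.Tautology) (φ ψ χ : Fm K) :
    Derives Φ (p.inst fun n => Nat.casesOn n φ fun n => Nat.casesOn n ψ fun _ => χ) :=
  ax (.taut p hp _)

open PropFm in
theorem imp_refl (φ : Fm K) : Derives Φ (φ.imp φ) :=
  taut ((var 0).imp (var 0)) (fun _ => id) φ φ φ

open PropFm in
theorem imp_intro (φ : Fm K) (h : Derives Φ ψ) : Derives Φ (φ.imp ψ) :=
  mp h (taut ((var 0).imp ((var 1).imp (var 0))) (fun _ h _ => h) ψ φ φ)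

open PropFm in
theorem imp_mp (h₁ : Derives Φ (φ.imp ψ)) (h₂ : Derives Φ (φ.imp (ψ.imp χ))) :
    Derives Φ (φ.imp χ) :=
  mp h₁ (mp h₂ (taut (((var 0).imp ((var 1).imp (var 2))).imp
    (((var 0).imp (var 1)).imp ((var 0).imp (var 2)))) (fun _ h h' a => h a (h' a)) φ ψ χ))

open PropFm in
theorem of_neg_imp_bot (h : Derives Φ (φ.neg.imp (.cst .bot))) : Derives Φ φ :=
  mp h (taut (((var 0).neg.imp bot).imp (var 0)) (fun _ h => Classical.byContradiction h) φ φ φ)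

open PropFm in
theorem neg_of_imp_bot (h : Derives Φ (φ.imp (.cst .bot))) : Derives Φ φ.neg :=
  mp h (taut (((var 0).imp bot).imp (var 0).neg) (fun _ h => h) φ φ φ)

open PropFm in
theorem bot_of_neg (h : Derives Φ φ) (h' : Derives Φ φ.neg) : Derives Φ (.cst .bot) :=
  mp h (mp h' (taut ((var 0).neg.imp ((var 0).imp bot)) (fun _ h => h) φ φ φ))

open PropFm in
theorem of_bot (φ : Fm K) (h : Derives Φ (.cst .bot)) : Derives Φ φ :=
  mp h (taut (bot.imp (var 0)) (fun _ h => h.elim) φ φ φ)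

open PropFm in
theorem and_intro (h : Derives Φ φ) (h' : Derives Φ ψ) : Derives Φ (φ.and ψ) :=
  mp h' (mp h (taut ((var 0).imp ((var 1).imp ((var 0).and (var 1)))) (fun _ h h' => ⟨h, h'⟩)
    φ ψ ψ))

open PropFm in
theorem and_left (h : Derives Φ (φ.and ψ)) : Derives Φ φ :=
  mp h (taut (((var 0).and (var 1)).imp (var 0)) (fun _ h => h.1) φ ψ ψ)

open PropFm in
theorem and_right (h : Derives Φ (φ.and ψ)) : Derives Φ ψ :=
  mp h (taut (((var 0).and (var 1)).imp (var 1)) (fun _ h => h.2) φ ψ ψ)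

open PropFm in
theorem or_inl (ψ : Fm K) (h : Derives Φ φ) : Derives Φ (φ.or ψ) :=
  mp h (taut ((var 0).imp ((var 0).or (var 1))) (fun _ h => Or.inl h) φ ψ ψ)

open PropFm in
theorem or_inr (φ : Fm K) (h : Derives Φ ψ) : Derives Φ (φ.or ψ) :=
  mp h (taut ((var 1).imp ((var 0).or (var 1))) (fun _ h => Or.inr h) φ ψ ψ)

open PropFm in
theorem or_resolve_left (h : Derives Φ (φ.or ψ)) (h' : Derives Φ φ.neg) : Derives Φ ψ :=
  mp h' (mp h (taut (((var 0).or (var 1)).imp ((var 0).neg.imp (var 1)))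
    (fun _ h h' => Or.resolve_left h h') φ ψ ψ))

theorem deduction (h : Derives (insert φ Φ) ψ) : Derives Φ (φ.imp ψ) := by
  induction h with
  | hyp h =>
    rcases h with rfl | h
    · exact imp_refl _
    · exact imp_intro _ (hyp h)
  | ax h => exact imp_intro _ (ax h)
  | an h => exact imp_intro _ (an h)
  | mp _ _ ih₁ ih₂ => exact imp_mp ih₁ ih₂

theorem of_nf_eq (h : φ.nf = ψ.nf) (hφ : Derives Φ φ) : Derives Φ ψ := by
  have h₁ : Derives Φ φ.nf :=
    mp hφ (mp (ax (.ident_alpha _ _ φ.alpha_nf)) (ax (.ident_imp _ _)))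
  rw [h] at h₁
  exact mp h₁ (mp (ax (.ident_alpha _ _ ψ.nf_alpha)) (ax (.ident_imp _ _)))

/-- If the variable is not free in the premises, derivable formulas can be generalized. -/
theorem generalize {x : ℕ} (hΦ : ∀ ψ ∈ Φ, x ∉ ψ.fvar) (h : Derives Φ φ) (hx : x ∈ φ.fvar) :
    Derives Φ (φ.all x hx) := by
  induction h with
  | hyp h => exact absurd hx (hΦ _ h)
  | ax h => exact ax (.gen _ _ hx h)
  -- Generalize the axiom before necessitating it, then move the quantifier out of the box.
  | @an φ h => exact mp (an (.gen x φ hx h)) (ax (.box_all x φ hx))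
  | @mp φ ψ h₁ _ ih₁ ih₂ =>
    -- If `x` is not free in the minor premise, quantifying it would not give a formula; the second
    -- distribution axiom covers this case.
    by_cases hφ : x ∈ φ.fvar
    · exact mp (ih₁ hφ) (mp (ih₂ _) (ax (.all_imp x φ ψ hφ hx)))
    · exact mp h₁ (mp (ih₂ _) (ax (.all_imp_const x φ ψ hφ hx)))

theorem all_of_subst1 {x z : ℕ} (hx : x ∈ φ.fvar) (hΦ : ∀ ψ ∈ Φ, z ∉ ψ.fvar)
    (hz : z ∉ φ.fvar) (h : Derives Φ (φ.subst1 x (.var z))) : Derives Φ (φ.all x hx) := by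
  refine of_nf_eq ?_ (h.generalize hΦ (Fm.mem_fvar_subst_update hx Fm.var z))
  refine (Fm.nf_all_subst hx fun u hu _ => ?_).trans (Fm.nf_nf _)
  rw [Fm.fvar_var, Finset.mem_singleton]
  rintro rfl
  exact hz hu

end Derives

/-! ### Henkin sets extending finite consistent sets -/

/-- Maximal consistent sets of formulas with variables as witnesses. -/
structure IsHenkin (T : Set (Fm K)) : Prop where
  mem_of_derives : ∀ {φ : Fm K}, Derives T φ → φ ∈ T
  neg_mem_iff : ∀ {φ : Fm K}, φ.neg ∈ T ↔ φ ∉ T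
  all_mem : ∀ {x : ℕ} {φ : Fm K} (hx : x ∈ φ.fvar),
    (∀ z : ℕ, φ.subst1 x (.var z) ∈ T) → φ.all x hx ∈ T

def Consistent (Φ : Set (Fm K)) : Prop := ¬ Derives Φ (.cst .bot)

theorem consistent_insert_or (Φ : Set (Fm K)) (φ : Fm K) :
    Consistent (insert φ Φ) ∨ Derives Φ φ.neg := by
  by_contra! hc
  exact hc.2 (Derives.neg_of_imp_bot (Derives.deduction (not_not.1 hc.1)))

theorem consistent_insert_neg {Φ : Set (Fm K)} {φ : Fm K} (h : ¬ Derives Φ φ) :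
    Consistent (insert φ.neg Φ) :=
  fun hc => h (Derives.of_neg_imp_bot hc.deduction)

theorem Consistent.insert_of_derives {Φ : Set (Fm K)} (h : Consistent Φ) {φ : Fm K}
    (hφ : Derives Φ φ) : Consistent (insert φ Φ) :=
  fun hc => h (hφ.mp hc.deduction)

/-- `Φ` decides `φ`, and has a witness if `φ` is a universal formula that fails. -/
def Decides (Φ : Set (Fm K)) (φ : Fm K) : Prop :=
  φ ∈ Φ ∨ φ.neg ∈ Φ ∧ ∀ (x : ℕ) (ψ : Fm K) (hx : x ∈ ψ.fvar), φ = ψ.all x hx →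
    ∃ z : ℕ, (ψ.subst1 x (.var z)).neg ∈ Φ

theorem Consistent.exists_decides {Φ : Set (Fm K)} (h : Consistent Φ) (hfin : Φ.Finite)
    (φ : Fm K) : ∃ Ψ : Set (Fm K), Φ ⊆ Ψ ∧ Ψ.Finite ∧ Consistent Ψ ∧ Decides Ψ φ := by
  rcases consistent_insert_or Φ φ with hφ | hφ
  · exact ⟨_, Set.subset_insert _ _, hfin.insert _, hφ, Or.inl (Set.mem_insert _ _)⟩
  have hneg := h.insert_of_derives hφ
  by_cases hall : ∃ (x : ℕ) (ψ : Fm K) (hx : x ∈ ψ.fvar), φ = ψ.all x hx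
  · obtain ⟨x, ψ, hx, rfl⟩ := hall
    -- Finiteness of `Φ` is what leaves a fresh variable to serve as witness.
    obtain ⟨z, hz⟩ := Infinite.exists_notMem_finset (hfin.toFinset.biUnion Fm.fvar ∪ ψ.fvar)
    simp only [Finset.mem_union, Finset.mem_biUnion, Set.Finite.mem_toFinset, not_or,
      not_exists, not_and] at hz
    have hz' : ¬ Derives (insert (ψ.all x hx).neg Φ) (ψ.subst1 x (.var z)) := by
      intro hd
      refine h (Derives.bot_of_neg ?_ hφ)
      exact (hφ.mp hd.deduction).all_of_subst1 hx hz.1 hz.2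
    refine ⟨_, (Set.subset_insert _ _).trans (Set.subset_insert _ _),
      (hfin.insert _).insert _, consistent_insert_neg hz', Or.inr ⟨by simp, ?_⟩⟩
    intro y χ hy heq
    obtain ⟨rfl, hχ⟩ := PreFm.all.inj (congrArg Subtype.val heq)
    obtain rfl := Fm.ext hχ
    exact ⟨z, by simp⟩
  · exact ⟨_, Set.subset_insert _ _, hfin.insert _, hneg, Or.inr ⟨Set.mem_insert _ _,
      fun x ψ hx h => absurd ⟨x, ψ, hx, h⟩ hall⟩⟩

theorem Decides.mono {Φ Ψ : Set (Fm K)} (h : Φ ⊆ Ψ) {φ : Fm K} (hd : Decides Φ φ) :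
    Decides Ψ φ :=
  hd.imp (fun hφ => h hφ) fun hφ => ⟨h hφ.1, fun x ψ hx he =>
    let ⟨z, hz⟩ := hφ.2 x ψ hx he
    ⟨z, h hz⟩⟩

/-- Compactness: Modus Ponens merges the premises of two derivations, and directedness supplies a
member containing both. -/
theorem exists_derives_of_directed {I : Set (Set (Fm K))} (hne : I.Nonempty)
    (hI : DirectedOn (· ⊆ ·) I) {φ : Fm K} (h : Derives (⋃₀ I) φ) : ∃ Φ ∈ I, Derives Φ φ := by
  induction h with
  | hyp h =>
    obtain ⟨Φ, hΦ, hφ⟩ := h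
    exact ⟨Φ, hΦ, .hyp hφ⟩
  | ax h => exact hne.imp fun Φ hΦ => ⟨hΦ, .ax h⟩
  | an h => exact hne.imp fun Φ hΦ => ⟨hΦ, .an h⟩
  | mp _ _ ih₁ ih₂ =>
    obtain ⟨Φ₁, hΦ₁, h₁⟩ := ih₁
    obtain ⟨Φ₂, hΦ₂, h₂⟩ := ih₂
    obtain ⟨Φ, hΦ, h₁', h₂'⟩ := hI Φ₁ hΦ₁ Φ₂ hΦ₂
    exact ⟨Φ, hΦ, (h₁.mono h₁').mp (h₂.mono h₂')⟩

/-- A directed union of consistent sets that decides every formula is a Henkin set. -/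
theorem isHenkin_sUnion {I : Set (Set (Fm K))} (hne : I.Nonempty)
    (hI : DirectedOn (· ⊆ ·) I) (hcon : ∀ Φ ∈ I, Consistent Φ) (hdec : ∀ φ, Decides (⋃₀ I) φ) :
    IsHenkin (⋃₀ I) := by
  have hcons : Consistent (⋃₀ I) := fun h =>
    let ⟨Φ, hΦ, h'⟩ := exists_derives_of_directed hne hI h
    hcon Φ hΦ h'
  have hneg {φ : Fm K} : φ.neg ∈ ⋃₀ I ↔ φ ∉ ⋃₀ I :=
    ⟨fun h h' => hcons (Derives.bot_of_neg (.hyp h') (.hyp h)),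
      fun h => ((hdec φ).resolve_left h).1⟩
  refine ⟨fun {φ} h => ?_, hneg, fun {x φ} hx h => ?_⟩
  · by_contra hφ
    exact hcons (Derives.bot_of_neg h (.hyp (hneg.2 hφ)))
  · by_contra hφ
    obtain ⟨z, hz⟩ := ((hdec _).resolve_left hφ).2 x φ hx rfl
    exact hneg.1 hz (h z)

/-- Rasiowa–Sikorski argument: among finite consistent sets ordered by inclusion, those deciding a
given formula are cofinal. There are countably many formulas, so some ideal containing `Φ` meets all
these cofinal sets; its union is Henkin. -/
theorem Consistent.exists_isHenkin_of_countable [Countable K] {Φ : Set (Fm K)}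
    (h : Consistent Φ) (hfin : Φ.Finite) : ∃ T, IsHenkin T ∧ Φ ⊆ T := by
  have := Encodable.ofCountable (Fm K)
  let P := {Ψ : Set (Fm K) // Ψ.Finite ∧ Consistent Ψ}
  let D (φ : Fm K) : Order.Cofinal P :=
    { carrier := {Ψ | Decides Ψ.1 φ}
      isCofinal := fun Ψ =>
        let ⟨Ψ', h₁, h₂, h₃, h₄⟩ := Ψ.2.2.exists_decides Ψ.2.1 φ
        ⟨⟨Ψ', h₂, h₃⟩, h₄, h₁⟩ }
  let J := Order.idealOfCofinals (⟨Φ, hfin, h⟩ : P) D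
  have hΦ : (⟨Φ, hfin, h⟩ : P) ∈ J := Order.mem_idealOfCofinals _ _
  refine ⟨⋃₀ (Subtype.val '' (J : Set P)), isHenkin_sUnion ?_ ?_ ?_ ?_, ?_⟩
  · exact ⟨Φ, _, hΦ, rfl⟩
  · rintro _ ⟨Ψ₁, h₁, rfl⟩ _ ⟨Ψ₂, h₂, rfl⟩
    obtain ⟨Ψ, hΨ, h₁', h₂'⟩ := J.directed Ψ₁ h₁ Ψ₂ h₂
    exact ⟨Ψ.1, ⟨Ψ, hΨ, rfl⟩, h₁', h₂'⟩
  · rintro _ ⟨Ψ, _, rfl⟩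
    exact Ψ.2.2
  · intro φ
    obtain ⟨Ψ, hΨ, hΨ'⟩ := Order.cofinal_meets_idealOfCofinals (⟨Φ, hfin, h⟩ : P) D φ
    have hsub : Ψ.1 ⊆ ⋃₀ (Subtype.val '' (J : Set P)) :=
      Set.subset_sUnion_of_mem (Set.mem_image_of_mem _ hΨ')
    exact Decides.mono hsub hΨ
  · exact Set.subset_sUnion_of_mem (Set.mem_image_of_mem _ hΦ)

/-- Derivations push forward along `r`, so deductive closure pulls back. Witnesses survive because
they are variables, which `r` does not touch. -/
theorem IsHenkin.comap {L : Type v} {r : Cst K → Cst L} (ht : r .top = .top)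
    (hb : r .bot = .bot) {T : Set (Fm L)} (hT : IsHenkin T) : IsHenkin (Fm.map r ⁻¹' T) where
  mem_of_derives h :=
    hT.mem_of_derives ((h.map ht hb).mono (Set.image_preimage_subset _ _))
  neg_mem_iff {φ} := hT.neg_mem_iff (φ := φ.map r)
  all_mem {x φ} hx h := by
    refine hT.all_mem (φ := φ.map r) (by rwa [Fm.fvar_map]) fun z => ?_
    have := h z
    rw [Set.mem_preimage, Fm.map_subst1] at this
    exact this

theorem Consistent.exists_isHenkin {Φ : Set (Fm K)} (h : Consistent Φ) (hfin : Φ.Finite) :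
    ∃ T, IsHenkin T ∧ Φ ⊆ T := by
  classical
  let F : Set K := {k | ∃ φ ∈ Φ, Cst.other k ∈ φ.1.consts}
  have hF : F.Finite := by
    have : (⋃ φ ∈ Φ, φ.1.consts).Finite := hfin.biUnion fun φ _ => φ.1.finite_consts
    refine (this.preimage (f := Cst.other) fun _ _ _ _ h => Cst.other.inj h).subset ?_
    rintro k ⟨φ, hφ, hk⟩
    exact Set.mem_biUnion hφ hk
  have : Countable F := hF.countable
  let r : Cst K → Cst F
    | .top => .top
    | .bot => .bot
    -- Constants not occurring in `Φ` may be sent anywhere; `⊤` is an arbitrary choice.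
    | .other k => if hk : k ∈ F then .other ⟨k, hk⟩ else .top
  let s : Cst F → Cst K
    | .top => .top
    | .bot => .bot
    | .other k => .other k
  have hsr : ∀ φ ∈ Φ, (φ.map r).map s = φ := fun φ hφ => by
    refine Fm.ext (PreFm.map_map_of_consts fun c hc => ?_)
    cases c with
    | top | bot => rfl
    | other k => simp only [r, dif_pos (show k ∈ F from ⟨φ, hφ, hc⟩), s]
  -- An inconsistency in the small language would be carried back by `s` to one of `Φ` itself.
  have hcon : Consistent (Fm.map r '' Φ) := by
    intro hc
    refine h ((hc.map (r := s) rfl rfl).mono ?_)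
    rintro _ ⟨_, ⟨φ, hφ, rfl⟩, rfl⟩
    rwa [hsr φ hφ]
  obtain ⟨T, hT, hΦT⟩ := hcon.exists_isHenkin_of_countable (hfin.image _)
  exact ⟨_, hT.comap (r := r) rfl rfl, Set.image_subset_iff.1 hΦT⟩

/-! ### Truth conditions and identity in a Henkin set -/

namespace IsHenkin

variable {T : Set (Fm K)} (hT : IsHenkin T) {φ ψ χ : Fm K}
include hT

theorem mp (h : φ ∈ T) (h' : φ.imp ψ ∈ T) : ψ ∈ T :=
  hT.mem_of_derives (Derives.mp (.hyp h) (.hyp h'))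

theorem mem_of_ax (h : AXminus φ) : φ ∈ T := hT.mem_of_derives (.ax h)

theorem bot_notMem : Fm.cst .bot ∉ T := fun h =>
  hT.neg_mem_iff.1 (hT.mem_of_derives (Derives.of_bot _ (.hyp h))) h

theorem top_mem : Fm.cst .top ∈ T :=
  hT.mem_of_ax (.taut .top (fun _ => trivial) Fm.var)

theorem imp_mem_iff : φ.imp ψ ∈ T ↔ φ ∉ T ∨ ψ ∈ T := by
  refine ⟨fun h => or_iff_not_imp_left.2 fun hφ => hT.mp (not_not.1 hφ) h, ?_⟩
  rintro (h | h)
  · refine hT.mem_of_derives (Derives.deduction (Derives.of_bot _ (Derives.bot_of_neg (φ := φ)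
      (.hyp (Set.mem_insert _ _)) (.hyp (Set.mem_insert_of_mem _ (hT.neg_mem_iff.2 h))))))
  · exact hT.mem_of_derives (Derives.imp_intro _ (.hyp h))

theorem and_mem_iff : φ.and ψ ∈ T ↔ φ ∈ T ∧ ψ ∈ T :=
  ⟨fun h => ⟨hT.mem_of_derives (Derives.and_left (.hyp h)),
      hT.mem_of_derives (Derives.and_right (.hyp h))⟩,
    fun h => hT.mem_of_derives (Derives.and_intro (.hyp h.1) (.hyp h.2))⟩

theorem or_mem_iff : φ.or ψ ∈ T ↔ φ ∈ T ∨ ψ ∈ T := by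
  refine ⟨fun h => or_iff_not_imp_left.2 fun hφ => hT.mem_of_derives
    (Derives.or_resolve_left (.hyp h) (.hyp (hT.neg_mem_iff.2 hφ))), ?_⟩
  rintro (h | h)
  · exact hT.mem_of_derives (Derives.or_inl _ (.hyp h))
  · exact hT.mem_of_derives (Derives.or_inr _ (.hyp h))

theorem mem_iff_of_nf_eq (h : φ.nf = ψ.nf) : φ ∈ T ↔ ψ ∈ T :=
  ⟨fun hφ => hT.mem_of_derives (Derives.of_nf_eq h (.hyp hφ)),
    fun hψ => hT.mem_of_derives (Derives.of_nf_eq h.symm (.hyp hψ))⟩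

theorem ident_of_nf_eq (h : φ.nf = ψ.nf) : φ.ident ψ ∈ T :=
  (hT.mem_iff_of_nf_eq (Fm.nf_ident_congr rfl ((Fm.nf_nf φ).trans h))).1
    (hT.mem_of_ax (.ident_alpha _ _ φ.alpha_nf))

theorem ident_subst1 (x : ℕ) (χ : Fm K) (h : φ.ident ψ ∈ T) :
    (χ.subst1 x φ).ident (χ.subst1 x ψ) ∈ T := by
  by_cases hx : x ∈ χ.fvar
  · exact hT.mp h (hT.mem_of_ax (.ident_subst x χ φ ψ hx))
  · rw [Fm.subst1_of_notMem hx, Fm.subst1_of_notMem hx]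
    exact hT.ident_of_nf_eq rfl

theorem mem_of_ident (h : φ.ident ψ ∈ T) (hφ : φ ∈ T) : ψ ∈ T :=
  hT.mp hφ (hT.mp h (hT.mem_of_ax (.ident_imp _ _)))

/-- Leibniz's argument: replace `φ` by `ψ` in the context `x ≡ φ` with `x` fresh, starting from
reflexivity. Transitivity uses the context `φ ≡ x` in the same way. -/
theorem ident_symm (h : φ.ident ψ ∈ T) : ψ.ident φ ∈ T := by
  obtain ⟨x, hx⟩ := Infinite.exists_notMem_finset φ.fvar
  have key (θ : Fm K) : ((((Fm.var x).ident φ).subst1 x θ)) = θ.ident φ.nf := by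
    change ((Fm.var x).subst1 x θ).ident (φ.subst1 x θ) = _
    rw [Fm.subst1_of_notMem hx, Fm.subst1, Fm.var_subst, Function.update_self]
  have h' := hT.ident_subst1 x ((Fm.var x).ident φ) h
  rw [key, key] at h'
  exact (hT.mem_iff_of_nf_eq (Fm.nf_ident_congr rfl (Fm.nf_nf φ))).1
    (hT.mem_of_ident h' (hT.ident_of_nf_eq (Fm.nf_nf φ).symm))

theorem ident_trans (h : φ.ident ψ ∈ T) (h' : ψ.ident χ ∈ T) : φ.ident χ ∈ T := by
  obtain ⟨x, hx⟩ := Infinite.exists_notMem_finset φ.fvar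
  have key (θ : Fm K) : ((φ.ident (Fm.var x)).subst1 x θ) = φ.nf.ident θ := by
    change (φ.subst1 x θ).ident ((Fm.var x).subst1 x θ) = _
    rw [Fm.subst1_of_notMem hx, Fm.subst1, Fm.var_subst, Function.update_self]
  have h'' := hT.ident_subst1 x (φ.ident (Fm.var x)) h'
  rw [key, key] at h''
  have nf_iff (θ : Fm K) : φ.nf.ident θ ∈ T ↔ φ.ident θ ∈ T :=
    hT.mem_iff_of_nf_eq (Fm.nf_ident_congr (Fm.nf_nf φ) rfl)
  exact (nf_iff χ).1 (hT.mem_of_ident h'' ((nf_iff ψ).2 h))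

theorem ident_box (h : φ.ident ψ ∈ T) : φ.box.ident ψ.box ∈ T := by
  have key (θ : Fm K) : (Fm.var 0).box.subst1 0 θ = θ.box := rfl
  have := hT.ident_subst1 0 (Fm.var 0).box h
  rwa [key, key] at this

/-- Substituting a fresh variable for `x` first reduces this to the single substitution of the
axiom. -/
theorem ident_subst_update (χ : Fm K) (σ : ℕ → Fm K) (x : ℕ) (h : φ.ident ψ ∈ T) :
    (χ.subst (Function.update σ x φ)).ident (χ.subst (Function.update σ x ψ)) ∈ T := by
  have hz (θ : Fm K) := Fm.nf_subst_update_subst1 (z := χ.bound σ x) (σ := σ) θ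
    fun u => Fm.bound_notMem (x := x)
  exact (hT.mem_iff_of_nf_eq (Fm.nf_ident_congr (hz φ) (hz ψ))).1 (hT.ident_subst1 _ _ h)

/-- Switch from `σ` to `τ` one free variable at a time. This makes denotations independent of
representatives. -/
theorem ident_subst (χ : Fm K) {σ τ : ℕ → Fm K} (h : ∀ x ∈ χ.fvar, (σ x).ident (τ x) ∈ T) :
    (χ.subst σ).ident (χ.subst τ) ∈ T := by
  have key : ∀ s ⊆ χ.fvar,
      (χ.subst σ).ident (χ.subst fun x => if x ∈ s then τ x else σ x) ∈ T := by
    intro s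
    induction s using Finset.induction_on with
    | empty =>
      intro _
      simpa using hT.ident_of_nf_eq rfl
    | insert a s ha ih =>
      intro hs
      refine hT.ident_trans (ih ((Finset.subset_insert _ _).trans hs)) ?_
      have := hT.ident_subst_update χ (fun x => if x ∈ s then τ x else σ x) a
        (h a (hs (Finset.mem_insert_self _ _)))
      convert this using 4 with x x
      · by_cases hxa : x = a
        · subst hxa; simp [ha]
        · simp [hxa]
      · by_cases hxa : x = a
        · subst hxa; simp
        · simp [hxa]
  have := key χ.fvar subset_rfl
  rwa [Fm.subst_congr (τ := τ) fun x hx => if_pos hx] at this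

theorem box_subst_mem_of_ax (h : AXminus φ) (σ : ℕ → Fm K) : (φ.subst σ).box ∈ T := by
  obtain ⟨χ, hχ, hχφ⟩ := h.exists_nf_eq_subst σ
  exact (hT.mem_iff_of_nf_eq (Fm.nf_box_congr hχφ)).1 (hT.mem_of_derives (.an hχ))

theorem subst_update_mem_of_all {x : ℕ} (hx : x ∈ φ.fvar) {σ : ℕ → Fm K}
    (h : (φ.all x hx).subst σ ∈ T) (ψ : Fm K) : φ.subst (Function.update σ x ψ) ∈ T := by
  rw [Fm.all_subst_eq] at h
  exact (hT.mem_iff_of_nf_eq (Fm.nf_subst_update_subst1 ψ fun u => Fm.bound_notMem)).1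
    (hT.mp h (hT.mem_of_ax (.all_elim _ _ ψ _)))

/-- The quantifier clause of the term model: every formula is an instance by `all_elim`, while the
instances by variables already suffice for the converse. -/
theorem all_subst_mem_iff {x : ℕ} (hx : x ∈ φ.fvar) (σ : ℕ → Fm K) :
    (φ.all x hx).subst σ ∈ T ↔ ∀ ψ, φ.subst (Function.update σ x ψ) ∈ T := by
  refine ⟨hT.subst_update_mem_of_all hx, fun h => ?_⟩
  rw [Fm.all_subst_eq]
  refine hT.all_mem _ fun z => ?_
  exact (hT.mem_iff_of_nf_eq (Fm.nf_subst_update_subst1 (.var z) fun u => Fm.bound_notMem)).2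
    (h _)

theorem box_subst_update_mem_of_box_all {x : ℕ} (hx : x ∈ φ.fvar) {σ : ℕ → Fm K}
    (h : ((φ.all x hx).subst σ).box ∈ T) (ψ : Fm K) :
    (φ.subst (Function.update σ x ψ)).box ∈ T := by
  refine hT.subst_update_mem_of_all (φ := φ.box) hx ?_ ψ
  rw [Fm.all_subst_eq] at h
  exact (congrArg (· ∈ T) (Fm.all_subst_eq (φ := φ.box) hx σ)).mpr
    (hT.mp h (hT.mem_of_ax (.box_all _ _ _)))

end IsHenkin

/-! ### The ultraproduct of the term models -/

open Filter

/-- A quotient of the ultrapower of the set of formulas: families are identified if, for almost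
all indices, the theory at that index proves them identical. -/
structure UltraQuotient {I : Type w} (U : Ultrafilter I) (T : I → Set (Fm K)) (M : Type v) where
  proj : (I → Fm K) → M
  surjective : Function.Surjective proj
  proj_eq_iff : ∀ a b, proj a = proj b ↔ ∀ᶠ i in U, (a i).ident (b i) ∈ T i

/-- The quotient exists, at every universe level that is large enough. -/
theorem nonempty_ultraQuotient {I : Type u} (U : Ultrafilter I) (T : I → Set (Fm K))
    (hT : ∀ i, IsHenkin (T i)) : ∃ M : Type (max u v), Nonempty (UltraQuotient U T M) := by
  let s : Setoid (I → Fm K) :=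
    { r := fun a b => ∀ᶠ i in U, (a i).ident (b i) ∈ T i
      iseqv :=
        { refl := fun a => .of_forall fun i => (hT i).ident_of_nf_eq rfl
          symm := fun h => h.mono fun i => (hT i).ident_symm
          trans := fun h h' => (h.and h').mono fun i hi => (hT i).ident_trans hi.1 hi.2 } }
  exact ⟨ULift.{max u v} (Quotient s), ⟨{
    proj := fun a => ⟨Quotient.mk s a⟩
    surjective := by
      rintro ⟨a⟩
      obtain ⟨a, rfl⟩ := Quotient.exists_rep a
      exact ⟨a, rfl⟩
    proj_eq_iff := fun a b => by
      rw [ULift.up_inj]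
      exact Quotient.eq }⟩⟩

namespace UltraQuotient

variable {I : Type w} {U : Ultrafilter I} {T : I → Set (Fm K)} {M : Type v}
  (q : UltraQuotient U T M)

/-- The denotation of a formula under an assignment. -/
noncomputable def ext (γ : ℕ → M) (φ : Fm K) : M :=
  q.proj fun i => φ.subst fun x => Function.surjInv q.surjective (γ x) i

/-- The image of the families of formulas that are almost everywhere in the theory. -/
def image (P : I → Set (Fm K)) : Set M := {m | ∃ a, q.proj a = m ∧ ∀ᶠ i in U, a i ∈ P i}

theorem exists_eq_proj (γ : ℕ → M) : ∃ s : ℕ → I → Fm K, γ = fun x => q.proj (s x) :=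
  ⟨fun x => Function.surjInv q.surjective (γ x),
    funext fun x => (Function.surjInv_eq q.surjective (γ x)).symm⟩

theorem update_proj (s : ℕ → I → Fm K) (x : ℕ) (a : I → Fm K) :
    Function.update (fun u => q.proj (s u)) x (q.proj a) =
      fun u => q.proj (Function.update s x a u) := by
  funext u
  by_cases h : u = x
  · subst h; simp
  · simp only [Function.update_of_ne h]

theorem proj_mem_image {P : I → Set (Fm K)}
    (hP : ∀ i φ ψ, φ.ident ψ ∈ T i → φ ∈ P i → ψ ∈ P i) (a : I → Fm K) :
    q.proj a ∈ q.image P ↔ ∀ᶠ i in U, a i ∈ P i := by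
  refine ⟨?_, fun h => ⟨a, rfl, h⟩⟩
  rintro ⟨b, hb, h⟩
  filter_upwards [(q.proj_eq_iff b a).1 hb, h] with i hi hi'
  exact hP i _ _ hi hi'

variable (hT : ∀ i, IsHenkin (T i))
include hT

theorem ext_proj (s : ℕ → I → Fm K) (φ : Fm K) :
    q.ext (fun x => q.proj (s x)) φ = q.proj fun i => φ.subst fun x => s x i := by
  refine (q.proj_eq_iff _ _).2 ?_
  -- The chosen representatives agree with `s x` only almost everywhere, separately for each `x`;
  -- finitely many free variables allow a common set of indices.
  have h : ∀ᶠ i in U, ∀ x ∈ φ.fvar,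
      (Function.surjInv q.surjective (q.proj (s x)) i).ident (s x i) ∈ T i := by
    rw [Filter.eventually_all_finset]
    exact fun x _ => (q.proj_eq_iff _ _).1 (Function.surjInv_eq q.surjective _)
  filter_upwards [h] with i hi
  exact (hT i).ident_subst φ hi

theorem proj_mem_true (a : I → Fm K) : q.proj a ∈ q.image T ↔ ∀ᶠ i in U, a i ∈ T i :=
  q.proj_mem_image (fun i _ _ => (hT i).mem_of_ident) a

theorem proj_mem_nec (a : I → Fm K) :
    q.proj a ∈ q.image (fun i => {φ | φ.box ∈ T i}) ↔ ∀ᶠ i in U, (a i).box ∈ T i :=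
  q.proj_mem_image (P := fun i => {φ | φ.box ∈ T i}) (fun i _ _ h h' =>
    (hT i).mem_of_ident ((hT i).ident_box h) h') a

theorem ext_mem_true (s : ℕ → I → Fm K) (φ : Fm K) :
    q.ext (fun x => q.proj (s x)) φ ∈ q.image T ↔ ∀ᶠ i in U, φ.subst (fun x => s x i) ∈ T i := by
  rw [q.ext_proj hT, q.proj_mem_true hT]

theorem ext_mem_nec (s : ℕ → I → Fm K) (φ : Fm K) :
    q.ext (fun x => q.proj (s x)) φ ∈ q.image (fun i => {φ | φ.box ∈ T i}) ↔
      ∀ᶠ i in U, (φ.subst fun x => s x i).box ∈ T i := by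
  rw [q.ext_proj hT, q.proj_mem_nec hT]

end UltraQuotient

theorem update_apply_eq_update {I : Type w} {α : Type v} (s : ℕ → I → α) (x : ℕ) (a : I → α) (i : I) :
    (fun u => Function.update s x a u i) = Function.update (fun u => s u i) x (a i) := by
  funext u
  by_cases h : u = x
  · subst h; simp
  · simp only [Function.update_of_ne h]

/-- The ultraproduct of the term models of a family of Henkin sets. -/
noncomputable def UltraQuotient.model {I : Type w} {U : Ultrafilter I} {T : I → Set (Fm K)}
    {M : Type v} (q : UltraQuotient U T M) (hT : ∀ i, IsHenkin (T i)) : SimpleModel.{u, v} K where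
  M := M
  nonempty := ⟨q.proj fun _ => Fm.var 0⟩
  TRUE := q.image T
  NEC := q.image fun i => {φ | φ.box ∈ T i}
  nec_subset := by
    rintro _ ⟨a, rfl, h⟩
    exact ⟨a, rfl, h.mono fun i hi => (hT i).mp hi ((hT i).mem_of_ax (.box_elim _))⟩
  Γ c := q.proj fun _ => Fm.cst c
  ext := q.ext
  ext_var γ x := by
    obtain ⟨s, rfl⟩ := q.exists_eq_proj γ
    rw [q.ext_proj hT]
    simp only [Fm.var_subst]
  ext_cst γ c := rfl
  coincidence γ γ' φ h := by
    unfold UltraQuotient.ext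
    congr 1
    funext i
    exact Fm.subst_congr fun x hx => by rw [h x hx]
  substitution σ γ φ := by
    obtain ⟨s, rfl⟩ := q.exists_eq_proj γ
    simp only [q.ext_proj hT, Fm.subst_subst]
  bot_not_true := by
    rw [q.proj_mem_true hT]
    intro h
    obtain ⟨i, hi⟩ := h.exists
    exact (hT i).bot_notMem hi
  top_true := ⟨_, rfl, .of_forall fun i => (hT i).top_mem⟩
  imp_true γ φ ψ := by
    obtain ⟨s, rfl⟩ := q.exists_eq_proj γ
    simp only [q.ext_mem_true hT, ← Ultrafilter.eventually_not, ← Ultrafilter.eventually_or]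
    exact eventually_congr (.of_forall fun i =>
      (hT i).imp_mem_iff (φ := φ.subst fun x => s x i) (ψ := ψ.subst fun x => s x i))
  neg_true γ φ := by
    obtain ⟨s, rfl⟩ := q.exists_eq_proj γ
    simp only [q.ext_mem_true hT, ← Ultrafilter.eventually_not]
    exact eventually_congr (.of_forall fun i =>
      (hT i).neg_mem_iff (φ := φ.subst fun x => s x i))
  and_true γ φ ψ := by
    obtain ⟨s, rfl⟩ := q.exists_eq_proj γ
    simp only [q.ext_mem_true hT, ← Filter.eventually_and]
    exact eventually_congr (.of_forall fun i =>
      (hT i).and_mem_iff (φ := φ.subst fun x => s x i) (ψ := ψ.subst fun x => s x i))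
  or_true γ φ ψ := by
    obtain ⟨s, rfl⟩ := q.exists_eq_proj γ
    simp only [q.ext_mem_true hT, ← Ultrafilter.eventually_or]
    exact eventually_congr (.of_forall fun i =>
      (hT i).or_mem_iff (φ := φ.subst fun x => s x i) (ψ := ψ.subst fun x => s x i))
  box_true γ φ := by
    obtain ⟨s, rfl⟩ := q.exists_eq_proj γ
    rw [q.ext_mem_true hT, q.ext_mem_nec hT]
    rfl
  ident_true γ φ ψ := by
    obtain ⟨s, rfl⟩ := q.exists_eq_proj γ
    rw [q.ext_mem_true hT, q.ext_proj hT, q.ext_proj hT, q.proj_eq_iff]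
    rfl
  all_true γ x φ hx := by
    obtain ⟨s, rfl⟩ := q.exists_eq_proj γ
    rw [q.ext_mem_true hT]
    constructor
    · intro h a
      obtain ⟨a, rfl⟩ := q.surjective a
      rw [q.update_proj, q.ext_mem_true hT]
      filter_upwards [h] with i hi
      rw [update_apply_eq_update]
      exact ((hT i).all_subst_mem_iff hx _).1 hi _
    · intro h
      -- As in Łoś's theorem, pick at each index a counterexample if there is one. The class of the
      -- resulting family tests the universal formula at almost all indices at once.
      have hψ (i : I) : ∃ ψ, φ.subst (Function.update (fun u => s u i) x ψ) ∈ T i →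
          (φ.all x hx).subst (fun u => s u i) ∈ T i := by
        by_contra! hc
        exact (hc (.var 0)).2 (((hT i).all_subst_mem_iff hx _).2 fun ψ => (hc ψ).1)
      choose a ha using hψ
      have := h (q.proj a)
      rw [q.update_proj, q.ext_mem_true hT] at this
      filter_upwards [this] with i hi
      rw [update_apply_eq_update] at hi
      exact ha i hi
  imp_nec γ φ ψ := by
    obtain ⟨s, rfl⟩ := q.exists_eq_proj γ
    rw [q.ext_mem_nec hT, q.ext_mem_nec hT]
    exact fun h => h.mono fun i hi => (hT i).mp hi ((hT i).mem_of_ax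
      (.box_imp_box (φ.subst fun x => s x i) (ψ.subst fun x => s x i)))
  all_nec γ x φ hx h a := by
    obtain ⟨s, rfl⟩ := q.exists_eq_proj γ
    obtain ⟨a, rfl⟩ := q.surjective a
    rw [q.ext_mem_nec hT] at h
    rw [q.update_proj, q.ext_mem_nec hT]
    filter_upwards [h] with i hi
    rw [update_apply_eq_update]
    exact (hT i).box_subst_update_mem_of_box_all hx hi _

namespace UltraQuotient

variable {I : Type w} {U : Ultrafilter I} {T : I → Set (Fm K)} {M : Type v}
  (q : UltraQuotient U T M) (hT : ∀ i, IsHenkin (T i))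

theorem model_admissible : (q.model hT).Admissible := by
  intro γ φ h
  obtain ⟨s, rfl⟩ := q.exists_eq_proj γ
  exact (q.ext_mem_nec hT s φ).2 (.of_forall fun i => (hT i).box_subst_mem_of_ax h _)

/-- Under the assignment of each variable to its own class, `φ` denotes the class of `φ.nf`, which a
Henkin set does not distinguish from `φ`. -/
theorem model_sat_iff (φ : Fm K) :
    (q.model hT).Sat (fun x => q.proj fun _ => .var x) φ ↔ ∀ᶠ i in U, φ ∈ T i := by
  refine (q.ext_mem_true hT _ φ).trans (eventually_congr (.of_forall fun i => ?_))
  exact (hT i).mem_iff_of_nf_eq (Fm.nf_nf φ)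

end UltraQuotient

/-! ### Model existence, soundness and completeness -/

theorem Consistent.exists_model {Φ : Set (Fm K)} (h : Consistent Φ) :
    ∃ (𝓜 : SimpleModel.{u, max u v} K) (γ : ℕ → 𝓜.M), 𝓜.Admissible ∧ ∀ φ ∈ Φ, 𝓜.Sat γ φ := by
  classical
  have hex (F : Finset (Fm K)) : ∃ T, IsHenkin T ∧ ↑F ∩ Φ ⊆ T :=
    Consistent.exists_isHenkin (fun hc => h (hc.mono Set.inter_subset_right))
      (F.finite_toSet.inter_of_left Φ)
  choose T hT hFT using hex
  -- Refining `atTop` makes every cone `{F | {φ} ≤ F}` large, and on it `φ ∈ Φ` belongs to the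
  -- chosen Henkin sets.
  let U : Ultrafilter (Finset (Fm K)) := Ultrafilter.of atTop
  obtain ⟨M, ⟨q⟩⟩ := nonempty_ultraQuotient.{u, v} U T hT
  refine ⟨q.model hT, _, q.model_admissible hT, fun φ hφ => (q.model_sat_iff hT φ).2 ?_⟩
  refine (eventually_ge_atTop {φ}).filter_mono (Ultrafilter.of_le atTop) |>.mono fun F hF => ?_
  exact hFT F ⟨Finset.singleton_subset_iff.1 hF, hφ⟩

theorem Derives.entails {Φ : Set (Fm K)} {φ : Fm K} (h : Derives Φ φ) :
    Entails.{u, v} Φ φ := by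
  intro 𝓜 h𝓜 γ hγ
  induction h with
  | hyp h => exact hγ _ h
  | ax h => exact 𝓜.nec_subset (h𝓜 γ _ h)
  | an h => exact (𝓜.box_true γ _).2 (h𝓜 γ _ h)
  | mp _ _ ih₁ ih₂ => exact ((𝓜.imp_true γ _ _).1 ih₂).resolve_left fun h => h ih₁

theorem Entails.derives {Φ : Set (Fm K)} {φ : Fm K} (h : Entails.{u, v} Φ φ) :
    Derives Φ φ := by
  by_contra hφ
  obtain ⟨𝓜, γ, h𝓜, hγ⟩ := (consistent_insert_neg hφ).exists_model
  exact (𝓜.neg_true γ φ).1 (hγ _ (Set.mem_insert _ _))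
    (h 𝓜 h𝓜 γ fun ψ hψ => hγ ψ (Set.mem_insert_of_mem _ hψ))

end NonFregean

theorem theorem995 {K : Type u} (Φ : Set (NonFregean.Fm K)) (φ : NonFregean.Fm K) :
    NonFregean.Derives Φ φ ↔ NonFregean.Entails.{u, v} Φ φ :=
  ⟨NonFregean.Derives.entails, NonFregean.Entails.derives⟩
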